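/- Let $p\equiv 1\pmod 4$ be a prime, $m\ge 2$ an integer, $q=p^m$, $\zeta_p=e^{2\pi i/p}$, and let $\mathrm{Tr}$ be the trace from $\mathbb F_q$ to $\mathbb F_p$. For $f:\mathbb F_q\to\mathbb F_p$ and $\beta\in\mathbb F_q$ let $\widehat\chi_f(\beta)=\sum_{x\in\mathbb F_q}\zeta_p^{f(x)-\mathrm{Tr}(\beta x)}$. For $0\le s\le m$, $f$ is *$s$-plateaued* if $|\widehat\chi_f(\beta)|^2\in\{0,p^{m+s}\}$ for all $\beta$; put $\mathcal S_f=\{\beta:|\widehat\chi_f(\beta)|^2=p^{m+s}\}$. An $s$-plateaued $f$ is *weakly regular* if there are $u\in\mathbb C$ with $|u|=1$ and a function $f_0:\mathbb F_q\to\mathbb F_p$ vanishing off $\mathcal S_f$ with $\widehat\chi_f(\beta)\in\{0,\,u\,p^{(m+s)/2}\zeta_p^{f_0(\beta)}\}$ for all $\beta$. In that case there are a unique sign $\varepsilon_f\in\{\pm1\}$ and a unique function $f^\star:\mathbb F_q\to\mathbb F_p$ vanishing off $\mathcal S_f$ such that $\widehat\chi_f(\beta)=\varepsilon_f\sqrt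 p^{\,m+s}\zeta_p^{f^\star(\beta)}$ for $\beta\in\mathcal S_f$. Let WRP be the class of weakly regular plateaued $f$ with $\widehat\chi_f(0)\ne0$, $f(0)=0$, and $f(zx)=z^hf(x)$ for all $z\in\mathbb F_p^*$, $x\in\mathbb F_q$, for some even $h>0$ with $\gcd(h-1,p-1)=1$. We say that $f\in\mathrm{WRP}$ has index $l_f=l$ if $l$ is an even positive integer with $\gcd(l-1,p-1)=1$ and $f^\star(z\beta)=z^{l}f^\star(\beta)$ for all $z\in\mathbb F_p^*$, $\beta\in\mathcal S_f$. Let $f,g\in\mathrm{WRP}$ be $s$-plateaued and $t$-plateaued respectively, with $l_f=l_g=\frac{p-1}2$ and $s+t$ even. Put $\varepsilon=\varepsilon_f\varepsilon_g$, $\tau=2m+s+t$, $\gamma=2m-s-t$, and $D=\{(x,y)\in\mathbb F_q^2\setminus\{(0,0)\}:f(x)+g(y)=0\}$. Then there is a set $\overline D$ such that the sets $z\overline D$, $z\in\mathbb F_p^*$, form a partition of $D$, and for every such $\overline D$ the punctured code $$C=\{(\mathrm{Tr}(ax+by))_{(x,y)\in\overline D}:a,b\in\mathbb F_q\}$$ over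 $\mathbb F_p$ has the following properties. 1. $C$ is projective, i.e. its dual code has minimum distance at least $3$, and $C$ has length $\frac{p^{2m-1}-1}{p-1}+\varepsilon\sqrt p^{\,\tau-2}$. 2. Unless $\gamma=2$ and $\varepsilon=-1$, $C$ has dimension $2m$ and the following weight distribution: | weight | frequency | |---|---| | $0$ | $1$ | | $p^{2m-2}$ | $p^{\gamma-1}+(p-1)\varepsilon\sqrt p^{\,\gamma-2}-1$ | | $p^{2m-2}+\varepsilon\sqrt p^{\,\tau-2}$ | $(p-1)\left(p^{\gamma-1}-\varepsilon\sqrt p^{\,\gamma-2}\right)$ | | $p^{2m-2}+(p-1)\varepsilon\sqrt p^{\,\tau-4}$ | $p^{2m}-p^{\gamma}$ | If moreover $0<s+t<2m$, then $C$ is a three-weight code, i.e. exactly three positive integers occur as weights of codewords. (For $s=t=0$ or $s=t=m$ some frequencies in the table are $0$.) 3. If $\tau=4$ and $\varepsilon=-1$, then $C$ meets the Griesmer bound: its length equals $\sum_{i=0}^{k-1}\lceil d/p^i\rceil$, where $k$ is its dimension and $d$ its minimum distance. -/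

import Mathlib

noncomputable section

namespace PlateauedCode

/-! ### Weakly regular plateaued functions -/

section Plateaued

variable {p : ℕ} [Fact p.Prime] {F : Type*} [Field F] [Fintype F] [Algebra (ZMod p) F]

/-- The Walsh transform `β ↦ ∑ x, ζ_p ^ (f x - Tr (β x))`, where `ζ_p = exp (2 π i / p)`
(`ZMod.stdAddChar c = ζ_p ^ c`) and `Tr` is the absolute trace. -/
def walsh (f : F → ZMod p) (β : F) : ℂ :=
  ∑ x : F, ZMod.stdAddChar (f x - Algebra.trace (ZMod p) F (β * x))

/-- The Walsh support of an `s`-plateaued function. -/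
def walshSupport (f : F → ZMod p) (s : ℕ) : Set F :=
  {β | ‖walsh f β‖ ^ 2 = (p : ℝ) ^ (Module.finrank (ZMod p) F + s)}

/-- `f` is `s`-plateaued, `0 ≤ s ≤ m`: its squared absolute Walsh values are `0` or `p ^ (m + s)`. -/
def IsPlateaued (f : F → ZMod p) (s : ℕ) : Prop :=
  s ≤ Module.finrank (ZMod p) F ∧
    ∀ β : F, ‖walsh f β‖ ^ 2 = 0 ∨ ‖walsh f β‖ ^ 2 = (p : ℝ) ^ (Module.finrank (ZMod p) F + s)

/-- `f` is weakly regular `s`-plateaued: with one `u` of modulus `1`, all Walsh values are `0` or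
`u p ^ ((m + s) / 2) ζ_p ^ (g β)`, where `g` vanishes off the Walsh support. -/
def IsWeaklyRegular (f : F → ZMod p) (s : ℕ) : Prop :=
  IsPlateaued f s ∧
    ∃ u : ℂ, ‖u‖ = 1 ∧ ∃ g : F → ZMod p,
      (∀ β, β ∉ walshSupport f s → g β = 0) ∧
      ∀ β, walsh f β = 0 ∨
        walsh f β = u * ((√(p : ℝ) : ℝ) : ℂ) ^ (Module.finrank (ZMod p) F + s)
          * ZMod.stdAddChar (g β)

/-- The class WRP: weakly regular unbalanced `s`-plateaued functions with `f 0 = 0` that are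
homogeneous under `F_p^*` of an even positive degree `h` with `gcd (h - 1, p - 1) = 1`. -/
structure IsWRP (f : F → ZMod p) (s : ℕ) : Prop where
  weaklyRegular : IsWeaklyRegular f s
  unbalanced : walsh f 0 ≠ 0
  map_zero : f 0 = 0
  homogeneous : ∃ h : ℕ, 0 < h ∧ Even h ∧ Nat.gcd (h - 1) (p - 1) = 1 ∧
    ∀ z : ZMod p, z ≠ 0 → ∀ x : F, f (z • x) = z ^ h * f x

open Classical in
/-- The sign `ε_f ∈ {1, -1}` of the Walsh transform of a weakly regular `s`-plateaued function, for
`p ≡ 1 (mod 4)`: on the Walsh support `walsh f β = ε_f √p ^ (m + s) ζ_p ^ (f* β)`.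
It is `1` if some Walsh value is `√p ^ (m + s)` times a power of `ζ_p`, and `-1` otherwise. -/
def walshSign (f : F → ZMod p) (s : ℕ) : ℤ :=
  if ∃ (β : F) (c : ZMod p),
      walsh f β = ((√(p : ℝ) : ℝ) : ℂ) ^ (Module.finrank (ZMod p) F + s) * ZMod.stdAddChar c
  then 1 else -1

open Classical in
/-- The dual function `f*`: `f* β` is the `c` with `walsh f β = ε_f √p ^ (m + s) ζ_p ^ c`; there is
no such `c` off the Walsh support, where `f* β = 0`. -/
def dualFun (f : F → ZMod p) (s : ℕ) (β : F) : ZMod p :=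
  if h : ∃ c : ZMod p,
      walsh f β = (walshSign f s : ℂ) * ((√(p : ℝ) : ℝ) : ℂ) ^ (Module.finrank (ZMod p) F + s)
        * ZMod.stdAddChar c
  then h.choose else 0

/-- `l` is an index `l_f` of `f`: an even positive integer with `gcd (l - 1, p - 1) = 1` such that
`f* (z β) = z ^ l f* β` for all `z ∈ F_p^*` and all `β` in the Walsh support. -/
def IsIndex (f : F → ZMod p) (s l : ℕ) : Prop :=
  0 < l ∧ Even l ∧ Nat.gcd (l - 1) (p - 1) = 1 ∧
    ∀ z : ZMod p, z ≠ 0 → ∀ β ∈ walshSupport f s, dualFun f s (z • β) = z ^ l * dualFun f s β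

/-- The defining set `{(x, y) ≠ (0, 0) : f x + g y = 0}`. -/
def definingSet (f g : F → ZMod p) : Set (F × F) :=
  {v | v ≠ 0 ∧ f v.1 + g v.2 = 0}

/-- `E` is a punctured defining set of `D`: the sets `z E`, `z ∈ F_p^*`, partition `D`. -/
def IsPuncturing (p : ℕ) [Fact p.Prime] {F : Type*} [Field F] [Fintype F] [Algebra (ZMod p) F]
    (D : Set (F × F)) (E : Finset (F × F)) : Prop :=
  (⋃ z : (ZMod p)ˣ, (fun v : F × F => (z : ZMod p) • v) '' (E : Set (F × F))) = D ∧
    Pairwise fun z w : (ZMod p)ˣ =>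
      Disjoint ((fun v : F × F => (z : ZMod p) • v) '' (E : Set (F × F)))
        ((fun v : F × F => (w : ZMod p) • v) '' (E : Set (F × F)))

/-- The codeword map `(a, b) ↦ (Tr (a x + b y))_{(x, y) ∈ E}`. -/
def codeMap (p : ℕ) [Fact p.Prime] {F : Type*} [Field F] [Fintype F] [Algebra (ZMod p) F]
    (E : Finset (F × F)) : (F × F) →ₗ[ZMod p] (E → ZMod p) where
  toFun ab v := Algebra.trace (ZMod p) F (ab.1 * v.1.1 + ab.2 * v.1.2)
  map_add' ab cd := by
    funext v
    simp only [Prod.fst_add, Prod.snd_add, Pi.add_apply, ← map_add]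
    congr 1
    ring
  map_smul' z ab := by
    funext v
    simp only [Prod.smul_fst, Prod.smul_snd, Pi.smul_apply, RingHom.id_apply, ← map_smul,
      smul_add, smul_mul_assoc]

/-- The linear code `C_E = {(Tr (a x + b y))_{(x, y) ∈ E} : a, b ∈ F}`. -/
def code (p : ℕ) [Fact p.Prime] {F : Type*} [Field F] [Fintype F] [Algebra (ZMod p) F]
    (E : Finset (F × F)) : Submodule (ZMod p) (E → ZMod p) :=
  LinearMap.range (codeMap p E)

end Plateaued

/-! ### Linear codes -/

section Codes

variable {p : ℕ} [Fact p.Prime] {ι : Type*} [Fintype ι]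

/-- The dual code, for the standard bilinear form. -/
def dualCode (C : Submodule (ZMod p) (ι → ZMod p)) : Submodule (ZMod p) (ι → ZMod p) where
  carrier := {w | ∀ c ∈ C, ∑ i, w i * c i = 0}
  add_mem' := by
    intro a b ha hb c hc
    simp [add_mul, Finset.sum_add_distrib, ha c hc, hb c hc]
  zero_mem' := by
    intro c _
    simp
  smul_mem' := by
    intro z a ha c hc
    simp [mul_assoc, ← Finset.mul_sum, ha c hc]

/-- The minimum distance of a linear code, the least weight of a nonzero codeword
(`⊤` for the zero code). -/
def minDist (C : Submodule (ZMod p) (ι → ZMod p)) : ℕ∞ :=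
  ⨅ c ∈ {c : ι → ZMod p | c ∈ C ∧ c ≠ 0}, (hammingNorm c : ℕ∞)

/-- A linear code is projective if its dual has minimum distance at least `3`. -/
def IsProjective (C : Submodule (ZMod p) (ι → ZMod p)) : Prop :=
  3 ≤ minDist (dualCode C)

/-- `A_w`, the number of codewords of Hamming weight `w`. -/
def weightCount (C : Submodule (ZMod p) (ι → ZMod p)) (w : ℕ) : ℕ :=
  {c : ι → ZMod p | c ∈ C ∧ hammingNorm c = w}.ncard

/-- The weight distribution of `C` is given by a table with rows `(weight, frequency)`. -/
def HasWeightDistribution (C : Submodule (ZMod p) (ι → ZMod p)) (table : List (ℝ × ℝ)) : Prop :=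
  ∀ w : ℕ, (weightCount C w : ℝ) =
    (table.map fun row => open Classical in if row.1 = (w : ℝ) then row.2 else 0).sum

/-- `C` is a `k`-weight code: exactly `k` positive integers occur as weights of codewords. -/
def IsWeightCode (C : Submodule (ZMod p) (ι → ZMod p)) (k : ℕ) : Prop :=
  {w : ℕ | 1 ≤ w ∧ weightCount C w ≠ 0}.ncard = k

/-- An `[n, k, d]` code over `F_p` meets the Griesmer bound if `n = ∑_{i < k} ⌈d / p ^ i⌉`. -/
def MeetsGriesmer (C : Submodule (ZMod p) (ι → ZMod p)) : Prop :=
  ∃ d : ℕ, minDist C = d ∧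
    Fintype.card ι = ∑ i ∈ Finset.range (Module.finrank (ZMod p) C), ⌈(d : ℚ) / (p : ℚ) ^ i⌉₊

end Codes

end PlateauedCode

end

noncomputable section

namespace PlateauedCode

/-! ### Galois conjugation and the sign of a Walsh value -/

section CharacterSums

variable {p : ℕ} [Fact p.Prime]

/-! Write `s + t = 2k`, `H(x, y) = f(x) + g(y)` and `B` for the trace form on `F × F`. The Walsh
transform of `H` is the product of those of `f` and `g`. It equals `r ζ^{H*}` on `S = S_f × S_g` and
`0` elsewhere, with `H* = f* + g*` and `r = ε p^(m+k)`. Since `r` is rational, the Galois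
conjugation `ζ ↦ ζ^y` just multiplies `H` and `H*` by `y` (`sum_stdAddChar_mul_eq`), so all zero
counts follow by summing over `y`.

A codeword's weight is determined by the number of `v` with `H v = B a v = 0`, which is a sum over
`y ≠ 0` and `z` of conjugates of the transform at `z a`. Off `S` only `z = 0` contributes. For
nonzero `a` in `S` the result depends only on whether `H* a = 0`, because `H*` is homogeneous. This
gives three weights. The frequencies come from Parseval (`|S| = p^(2(m-k))`) and from Fourier
inversion at `0`, which counts the zeros of `H*` on `S`.

Two facts about `f` and `g` are needed first. The sign `ε_f` exists because a sum of `p`-th roots of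
unity of modulus `√p^n` is `±√p^n ζ^c`: `p` is totally ramified in `ℤ[ζ]`, `√p` is a Gauss sum there
as `p ≡ 1 (mod 4)`, and the quotient is a unit of modulus `1` at every embedding, so a root of unity
by Kronecker. And `D` is stable under scalars because index `(p-1)/2` of the dual passes back to `f`
by Fourier inversion (`map_smul_of_isIndex`). -/

lemma stdAddChar_eq_pow_val (y c : ZMod p) :
    (ZMod.stdAddChar (y * c) : ℂ) = (ZMod.stdAddChar y) ^ c.val := by
  rw [← AddChar.map_nsmul_eq_pow, nsmul_eq_mul, ZMod.natCast_val, ZMod.cast_id', id, mul_comm]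

lemma isPrimitiveRoot_stdAddChar {y : ZMod p} (hy : y ≠ 0) :
    IsPrimitiveRoot (ZMod.stdAddChar y : ℂ) p := by
  have h : orderOf (ZMod.stdAddChar y : ℂ) = p := by
    refine orderOf_eq_prime ?_ fun h => hy ?_
    · rw [← AddChar.map_nsmul_eq_pow]; simp
    · exact ZMod.injective_stdAddChar (h.trans (AddChar.map_zero_eq_one _).symm)
  exact (IsPrimitiveRoot.iff_orderOf).2 h

/-- Galois conjugation: a rational linear relation between values of the additive character
is preserved when the arguments are multiplied by a nonzero scalar. -/
lemma sum_stdAddChar_mul_eq_zero {X : Type*} [Fintype X] (a : X → ℚ) (φ : X → ZMod p)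
    (h : ∑ x, (a x : ℂ) * ZMod.stdAddChar (φ x) = 0) {y : ZMod p} (hy : y ≠ 0) :
    ∑ x, (a x : ℂ) * ZMod.stdAddChar (y * φ x) = 0 := by
  -- The relation says `P(ζ) = 0`. Every nontrivial `ζ^y` has the same minimal polynomial, the
  -- `p`-th cyclotomic polynomial, so it is a root of `P` too.
  let P : Polynomial ℚ := ∑ x, Polynomial.C (a x) * Polynomial.X ^ (φ x).val
  have hP (z : ZMod p) : Polynomial.aeval (ZMod.stdAddChar z : ℂ) P
      = ∑ x, (a x : ℂ) * ZMod.stdAddChar (z * φ x) := by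
    simp [P, stdAddChar_eq_pow_val]
  have hmin {z : ZMod p} (hz : z ≠ 0) :
      Polynomial.cyclotomic p ℚ = minpoly ℚ (ZMod.stdAddChar z : ℂ) :=
    Polynomial.cyclotomic_eq_minpoly_rat (isPrimitiveRoot_stdAddChar hz)
      (Fact.out : p.Prime).pos
  have h1 : minpoly ℚ (ZMod.stdAddChar (1 : ZMod p) : ℂ) ∣ P := by
    apply minpoly.dvd
    rw [hP]
    simpa using h
  rw [← hmin one_ne_zero, hmin hy] at h1
  rw [← hP]
  exact Polynomial.aeval_eq_zero_of_dvd_aeval_eq_zero h1 (minpoly.aeval _ _)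

/-- The conjugation fixes `r` because `r` is rational; this is why the evenness of `s + t` matters
later. -/
lemma sum_stdAddChar_mul_eq {X : Type*} [Fintype X] (φ : X → ZMod p) (r : ℚ) (k : ZMod p)
    (h : ∑ x, (ZMod.stdAddChar (φ x) : ℂ) = r * ZMod.stdAddChar k) {y : ZMod p} (hy : y ≠ 0) :
    ∑ x, (ZMod.stdAddChar (y * φ x) : ℂ) = r * ZMod.stdAddChar (y * k) := by
  -- The extra index `none` carries the term `-r ζ^k`.
  have := sum_stdAddChar_mul_eq_zero (X := Option X) (fun o => o.elim (-r) (fun _ => 1))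
    (fun o => o.elim k φ) (by simp [h]) hy
  simp only [Fintype.sum_option, Option.elim_none, Option.elim_some] at this
  simp only [Rat.cast_neg, Rat.cast_one, one_mul] at this
  linear_combination this

open NumberField NumberField.IsCMField in
/-- A sum of `p`-th roots of unity of modulus `√p ^ n` is `± √p ^ n` times a `p`-th root of
unity. -/
lemma exists_eq_sqrt_pow_mul_stdAddChar (hp : p % 4 = 1) {X : Type*} [Fintype X]
    (φ : X → ZMod p) (n : ℕ)
    (h : ‖∑ x, (ZMod.stdAddChar (φ x) : ℂ)‖ ^ 2 = (p : ℝ) ^ n) :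
    ∃ c : ZMod p,
      ∑ x, (ZMod.stdAddChar (φ x) : ℂ) = ((√(p : ℝ) : ℝ) : ℂ) ^ n * ZMod.stdAddChar c ∨
      ∑ x, (ZMod.stdAddChar (φ x) : ℂ) = -(((√(p : ℝ) : ℝ) : ℂ) ^ n * ZMod.stdAddChar c) := by
  have hpp : p.Prime := Fact.out
  have hp2 : 2 < p := by have := hpp.two_le; omega
  suffices H : ∀ (K : Type) [Field K] [NumberField K] [IsCyclotomicExtension {p} ℚ K],
      ∃ c : ZMod p,
      ∑ x, (ZMod.stdAddChar (φ x) : ℂ) = ((√(p : ℝ) : ℝ) : ℂ) ^ n * ZMod.stdAddChar c ∨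
      ∑ x, (ZMod.stdAddChar (φ x) : ℂ) = -(((√(p : ℝ) : ℝ) : ℂ) ^ n * ZMod.stdAddChar c) by
    have : NeZero ((p : ℕ) : ℚ) := ⟨by exact_mod_cast hpp.ne_zero⟩
    have h1 := CyclotomicField.isCyclotomicExtension p ℚ
    -- Two `ℚ`-algebra structures on this field are identified here; any two are equal.
    have h2 : IsCyclotomicExtension {p} ℚ (CyclotomicField p ℚ) := by
      convert h1
      · rfl
      · exact Subsingleton.elim (α := Algebra ℚ (CyclotomicField p ℚ)) _ _
    exact H (CyclotomicField p ℚ)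
  intro K _ _ _
  have : IsCMField K := IsCyclotomicExtension.Rat.isCMField (S := {p}) K ⟨p, rfl, hp2⟩
  have hζ := IsCyclotomicExtension.zeta_spec p ℚ K
  set ζ := IsCyclotomicExtension.zeta p ℚ K
  obtain ⟨φ₀, hφ₀⟩ : ∃ φ₀ : K →+* ℂ, φ₀ ζ = ZMod.stdAddChar (1 : ZMod p) := by
    have hirr := Polynomial.cyclotomic.irreducible_rat hpp.pos
    refine ⟨((hζ.embeddingsEquivPrimitiveRoots ℂ hirr).symm
      ⟨ZMod.stdAddChar (1 : ZMod p), (mem_primitiveRoots hpp.pos).2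
        (isPrimitiveRoot_stdAddChar one_ne_zero)⟩).toRingHom, ?_⟩
    have := hζ.embeddingsEquivPrimitiveRoots_apply_coe ℂ hirr
      ((hζ.embeddingsEquivPrimitiveRoots ℂ hirr).symm
      ⟨ZMod.stdAddChar (1 : ZMod p), (mem_primitiveRoots hpp.pos).2
        (isPrimitiveRoot_stdAddChar one_ne_zero)⟩)
    simpa using this.symm
  set z := hζ.toInteger
  let j : 𝓞 K →+* ℂ := φ₀.comp (algebraMap (𝓞 K) K)
  have hj : Function.Injective j := φ₀.injective.comp RingOfIntegers.coe_injective
  have hjz : j z = ZMod.stdAddChar (1 : ZMod p) := hφ₀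
  let σ := ringOfIntegersComplexConj K
  have hσ (ψ : K →+* ℂ) (x : 𝓞 K) : ψ (σ x : 𝓞 K) = (starRingEnd ℂ) (ψ x) := by
    rw [coe_ringOfIntegersComplexConj, complexEmbedding_complexConj]
  have hjσ (x : 𝓞 K) : j (σ x) = (starRingEnd ℂ) (j x) := hσ φ₀ x
  have hjpow (c : ZMod p) : j (z ^ c.val) = ZMod.stdAddChar c := by
    rw [map_pow, hjz, ← stdAddChar_eq_pow_val, one_mul]
  -- the sum as an algebraic integer
  let A : 𝓞 K := ∑ x, z ^ (φ x).val
  have hjA : j A = ∑ x, (ZMod.stdAddChar (φ x) : ℂ) := by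
    simp only [A, map_sum, hjpow]
  have hAA : A * σ A = (p : 𝓞 K) ^ n := by
    apply hj
    rw [map_mul, hjσ, Complex.mul_conj, Complex.normSq_eq_norm_sq, hjA, h]
    simp
  -- the Gauss sum
  let ψ : AddChar (ZMod p) (𝓞 K) := AddChar.zmodChar p (ζ := z) (by
    exact hζ.toInteger_isPrimitiveRoot.pow_eq_one)
  have hψ : ψ.IsPrimitive :=
    AddChar.zmodChar_primitive_of_primitive_root p hζ.toInteger_isPrimitiveRoot
  let χ : MulChar (ZMod p) (𝓞 K) := (quadraticChar (ZMod p)).ringHomComp (Int.castRingHom (𝓞 K))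
  have hch : ringChar (ZMod p) ≠ 2 := by rw [ZMod.ringChar_zmod_n]; omega
  obtain ⟨G, hG⟩ : ∃ G : 𝓞 K, G ^ 2 = p := by
    refine ⟨gaussSum χ ψ, ?_⟩
    have hχ₁ : χ ≠ 1 := (MulChar.ringHomComp_ne_one_iff (RingHom.injective_int _)).2
      (quadraticChar_ne_one hch)
    have hχ₂ : χ.IsQuadratic := (quadraticChar_isQuadratic (ZMod p)).comp _
    rw [gaussSum_sq hχ₁ hχ₂ hψ, ZMod.card]
    -- The square of the Gauss sum is `χ(-1) p`, and `-1` is a square modulo `p`.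
    have : quadraticChar (ZMod p) (-1) = 1 := by
      rw [quadraticChar_neg_one hch, ZMod.card, ZMod.χ₄_nat_one_mod_four hp]
    simp [χ, this]
  -- everything is associated to a power of the prime above `p`
  have hπ : Prime (z - 1) := hζ.zeta_sub_one_prime'
  have hzσ : z * σ z = 1 := by
    apply hj
    rw [map_mul, hjσ, Complex.mul_conj, Complex.normSq_eq_norm_sq, hjz]
    simp
  -- `ζ⁻¹ - 1 = -ζ⁻¹ (ζ - 1)`: conjugation preserves the prime above `p`.
  have hσπ : Associated (σ (z - 1)) (z - 1) := by
    refine ⟨-(Units.mkOfMulEqOne _ _ hzσ), ?_⟩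
    rw [Units.val_neg, Units.val_mkOfMulEqOne, map_sub, map_one]
    linear_combination (-1 : 𝓞 K) * hzσ
  obtain ⟨N, hN⟩ : ∃ N, Associated (p : 𝓞 K) ((z - 1) ^ N) :=
    ⟨_, (IsCyclotomicExtension.Rat.associated_zeta_sub_one_pow_prime p hζ).symm⟩
  have hpn : Associated ((p : 𝓞 K) ^ n) ((z - 1) ^ (N * n)) := by
    rw [pow_mul]; exact hN.pow_pow
  obtain ⟨i, -, hi⟩ := (dvd_prime_pow hπ _).1
    ((Dvd.intro _ hAA).trans hpn.dvd)
  obtain ⟨l, -, hl⟩ := (dvd_prime_pow hπ _).1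
    ((Dvd.intro_left G (by rw [← hG, sq])).trans hN.dvd)
  have hi' : Associated (σ A) ((z - 1) ^ i) := by
    refine (hi.map σ).trans ?_
    rw [map_pow]
    exact hσπ.pow_pow
  -- Compare the exponents of `ζ - 1` in `A · σ A = p^n = G^n · G^n`.
  have hil : i + i = l * n + l * n := by
    have h1 : Associated ((p : 𝓞 K) ^ n) ((z - 1) ^ (i + i)) := by
      rw [← hAA, pow_add]; exact hi.mul_mul hi'
    have h2 : Associated ((p : 𝓞 K) ^ n) ((z - 1) ^ (l * n + l * n)) := by
      rw [← hG, ← pow_mul, mul_comm 2 n, pow_mul, sq, pow_add, pow_mul]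
      exact hl.pow_pow.mul_mul hl.pow_pow
    have h3 := h1.symm.trans h2
    exact le_antisymm ((pow_dvd_pow_iff hπ.ne_zero hπ.not_isUnit).1 h3.dvd)
      ((pow_dvd_pow_iff hπ.ne_zero hπ.not_isUnit).1 h3.symm.dvd)
  have hAG : Associated A (G ^ n) := by
    refine hi.trans ?_
    rw [show i = l * n by omega, pow_mul]
    exact hl.symm.pow_pow
  obtain ⟨u, hu⟩ := hAG
  -- the unit is a root of unity
  have hroot : ∃ (N : ℕ) (_ : 0 < N), ((u : 𝓞 K) : K) ^ N = 1 := by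
    refine Embeddings.pow_eq_one_of_norm_eq_one K ℂ (RingOfIntegers.isIntegral_coe _) ?_
    intro θ
    have hp0 : (0 : ℝ) < (p : ℝ) ^ n := by have := hpp.pos; positivity
    have h1 : ‖θ A‖ ^ 2 = (p : ℝ) ^ n := by
      have := congrArg (fun x : 𝓞 K => θ x) hAA
      simp only [map_mul, hσ, map_pow, map_natCast, Complex.mul_conj,
        Complex.normSq_eq_norm_sq] at this
      exact_mod_cast this
    have h2 : ‖θ G‖ ^ 2 = p := by
      have := congrArg (fun x : 𝓞 K => ‖θ x‖) hG
      simpa using this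
    have h3 : ‖θ A‖ * ‖θ (u : 𝓞 K)‖ = ‖θ G‖ ^ n := by
      have := congrArg (fun x : 𝓞 K => ‖θ x‖) hu
      simpa using this
    have h4 : (p : ℝ) ^ n * ‖θ (u : 𝓞 K)‖ ^ 2 = (p : ℝ) ^ n := by
      rw [← h1, ← mul_pow, h3, ← pow_mul, mul_comm n 2, pow_mul, h2, h1]
    have h5 : ‖θ (u : 𝓞 K)‖ ^ 2 = 1 := mul_left_cancel₀ hp0.ne' (by rw [h4, mul_one])
    exact (pow_eq_one_iff_of_nonneg (norm_nonneg _) two_ne_zero).1 h5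
  obtain ⟨r, hr⟩ := hζ.exists_neg_pow_of_isOfFinOrder (hpp.odd_of_ne_two (by omega))
    (isOfFinOrder_iff_pow_eq_one.2 (by simpa using hroot))
  have hju : j u = (-ZMod.stdAddChar (1 : ZMod p)) ^ r := by
    change φ₀ ((u : 𝓞 K) : K) = _
    rw [hr, map_pow, map_neg, hφ₀]
  have hjG : j G = ((√(p : ℝ) : ℝ) : ℂ) ∨ j G = -((√(p : ℝ) : ℝ) : ℂ) := by
    apply sq_eq_sq_iff_eq_or_eq_neg.1
    rw [← map_pow, hG, map_natCast, ← Complex.ofReal_pow, Real.sq_sqrt (Nat.cast_nonneg p)]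
    simp
  have hmain := congrArg j hu
  rw [map_mul, map_pow, hjA, hju] at hmain
  have hinv : (ZMod.stdAddChar (1 : ZMod p) : ℂ) ^ r * ZMod.stdAddChar (-(r : ZMod p)) = 1 := by
    rw [← AddChar.map_nsmul_eq_pow, ← AddChar.map_add_eq_mul]; simp
  have hsol : ∑ x, (ZMod.stdAddChar (φ x) : ℂ)
      = (-1) ^ r * (j G) ^ n * ZMod.stdAddChar (-(r : ZMod p)) := by
    rw [neg_pow] at hmain
    have hs : ((-1 : ℂ) ^ r) * (-1) ^ r = 1 := by rw [← mul_pow]; simp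
    rw [← hmain]
    linear_combination (-(∑ x, (ZMod.stdAddChar (φ x) : ℂ))) * hinv
      - (∑ x, (ZMod.stdAddChar (φ x) : ℂ)) * (ZMod.stdAddChar (1 : ZMod p) : ℂ) ^ r
        * ZMod.stdAddChar (-(r : ZMod p)) * hs
  refine ⟨-(r : ZMod p), ?_⟩
  rw [hsol]
  rcases neg_one_pow_eq_or ℂ r with h1 | h1 <;> rcases hjG with h2 | h2 <;>
    rcases neg_one_pow_eq_or ℂ n with h3 | h3 <;> simp [h1, h2, h3, neg_pow (√(p : ℝ) : ℂ) n]

end CharacterSums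

/-! ### Walsh transforms: inversion, Parseval, sign and homogeneity -/

section Walsh

variable {p : ℕ} [Fact p.Prime] {F : Type*} [Field F] [Fintype F] [Algebra (ZMod p) F]

lemma exists_trace_mul_ne_zero {β : F} (hβ : β ≠ 0) :
    ∃ x : F, Algebra.trace (ZMod p) F (β * x) ≠ 0 := by
  by_contra! h
  exact hβ ((traceForm_nondegenerate (ZMod p) F).1 β h)

/-- The additive character `x ↦ ζ_p ^ Tr (β x)`. -/
def traceChar (p : ℕ) [Fact p.Prime] {F : Type*} [Field F] [Fintype F] [Algebra (ZMod p) F]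
    (β : F) : AddChar F ℂ where
  toFun x := ZMod.stdAddChar (Algebra.trace (ZMod p) F (β * x))
  map_zero_eq_one' := by simp
  map_add_eq_mul' x y := by rw [mul_add, map_add, AddChar.map_add_eq_mul]

open Classical in
lemma sum_stdAddChar_trace (β : F) :
    ∑ x : F, (ZMod.stdAddChar (Algebra.trace (ZMod p) F (β * x)) : ℂ)
      = if β = 0 then (Fintype.card F : ℂ) else 0 := by
  split_ifs with h
  · simp [h]
  · refine AddChar.sum_eq_zero_of_ne_one (ψ := traceChar p β) fun h1 => ?_
    obtain ⟨x, hx⟩ := exists_trace_mul_ne_zero (p := p) h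
    refine hx (ZMod.injective_stdAddChar ?_)
    rw [AddChar.map_zero_eq_one]
    exact DFunLike.congr_fun h1 x

lemma card_eq_pow {m : ℕ} (hF : Module.finrank (ZMod p) F = m) : Fintype.card F = p ^ m := by
  rw [Module.card_eq_pow_finrank (K := ZMod p), ZMod.card, hF]

/-- Fourier inversion. -/
lemma sum_walsh_mul (f : F → ZMod p) (x : F) :
    ∑ β : F, walsh f β * ZMod.stdAddChar (Algebra.trace (ZMod p) F (β * x))
      = Fintype.card F * ZMod.stdAddChar (f x) := by
  classical
  have (β y : F) : (ZMod.stdAddChar (f y - Algebra.trace (ZMod p) F (β * y)) : ℂ)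
      * ZMod.stdAddChar (Algebra.trace (ZMod p) F (β * x))
      = ZMod.stdAddChar (f y) * ZMod.stdAddChar (Algebra.trace (ZMod p) F ((x - y) * β)) := by
    rw [← AddChar.map_add_eq_mul, ← AddChar.map_add_eq_mul, sub_mul, map_sub, mul_comm x, mul_comm y]
    congr 1
    ring
  simp_rw [walsh, Finset.sum_mul, this]
  rw [Finset.sum_comm]
  simp_rw [← Finset.mul_sum, sum_stdAddChar_trace, sub_eq_zero]
  simp [mul_comm]

lemma star_stdAddChar (c : ZMod p) :
    (starRingEnd ℂ) (ZMod.stdAddChar c) = ZMod.stdAddChar (-c) := by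
  rw [AddChar.map_neg_eq_inv, ← Complex.inv_eq_conj (AddChar.norm_apply _ c)]

lemma sum_norm_walsh_sq (f : F → ZMod p) :
    ∑ β : F, ‖walsh f β‖ ^ 2 = (Fintype.card F : ℝ) ^ 2 := by
  have h (β : F) : ((‖walsh f β‖ ^ 2 : ℝ) : ℂ) = ∑ x, ZMod.stdAddChar (-f x) *
      (walsh f β * ZMod.stdAddChar (Algebra.trace (ZMod p) F (β * x))) := by
    rw [← Complex.normSq_eq_norm_sq, Complex.normSq_eq_conj_mul_self]
    conv_lhs => rw [mul_comm]; arg 2; rw [walsh]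
    rw [map_sum, Finset.mul_sum]
    refine Finset.sum_congr rfl fun x _ => ?_
    rw [star_stdAddChar, neg_sub, sub_eq_add_neg, AddChar.map_add_eq_mul]
    ring
  have : ((∑ β : F, ‖walsh f β‖ ^ 2 : ℝ) : ℂ) = ((Fintype.card F : ℝ) ^ 2 : ℝ) := by
    rw [Complex.ofReal_sum]
    simp_rw [h]
    rw [Finset.sum_comm]
    simp_rw [← Finset.mul_sum, sum_walsh_mul]
    simp_rw [mul_left_comm, ← AddChar.map_add_eq_mul]
    simp [sq]
  exact_mod_cast this

variable {f : F → ZMod p} {s : ℕ}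

lemma walsh_eq_zero_iff (hf : IsPlateaued f s) {β : F} :
    walsh f β = 0 ↔ β ∉ walshSupport f s := by
  have hp := (Fact.out : p.Prime).pos
  constructor
  · intro h h1
    rw [walshSupport, Set.mem_ofPred_eq, h] at h1
    have : (0 : ℝ) < (p : ℝ) ^ (Module.finrank (ZMod p) F + s) := by positivity
    rw [← h1] at this
    simp at this
  · intro h
    simpa using (hf.2 β).resolve_right h

lemma walsh_ne_zero_iff (hf : IsPlateaued f s) {β : F} :
    walsh f β ≠ 0 ↔ β ∈ walshSupport f s := by
  rw [Ne, walsh_eq_zero_iff hf, not_not]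

/-- By Parseval, the points of the support contribute `p^(m+s)` each to a total of `p^(2m)`. -/
lemma ncard_walshSupport (hf : IsPlateaued f s) :
    (walshSupport f s).ncard * p ^ s = p ^ Module.finrank (ZMod p) F := by
  classical
  have hp := (Fact.out : p.Prime).pos
  have h := sum_norm_walsh_sq f
  have h1 (β : F) : ‖walsh f β‖ ^ 2
      = if β ∈ walshSupport f s then (p : ℝ) ^ (Module.finrank (ZMod p) F + s) else 0 := by
    split_ifs with h
    · exact h
    · rw [(walsh_eq_zero_iff hf).2 h]; simp
  simp_rw [h1] at h
  rw [← Finset.sum_filter, Finset.sum_const, card_eq_pow (p := p) rfl, nsmul_eq_mul,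
    ← Set.ncard_coe_finset] at h
  simp only [Finset.coe_filter, Finset.mem_univ, true_and, Set.ofPred_mem_eq] at h
  have h2 : (0 : ℝ) < (p : ℝ) ^ Module.finrank (ZMod p) F := by positivity
  have h3 : ((walshSupport f s).ncard : ℝ) * (p : ℝ) ^ s
      = (p : ℝ) ^ Module.finrank (ZMod p) F := by
    apply mul_left_cancel₀ h2.ne'
    push_cast at h
    rw [pow_add] at h
    linear_combination h
  exact_mod_cast h3

lemma dualFun_of_notMem (hf : IsPlateaued f s) {β : F} (hβ : β ∉ walshSupport f s) :
    dualFun f s β = 0 := by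
  rw [dualFun, dif_neg]
  rintro ⟨c, hc⟩
  have hp := (Fact.out : p.Prime).pos
  rw [(walsh_eq_zero_iff hf).2 hβ] at hc
  have h1 : ((√(p : ℝ) : ℝ) : ℂ) ≠ 0 := by
    rw [Complex.ofReal_ne_zero]; positivity
  have h2 : (walshSign f s : ℂ) ≠ 0 := by rw [walshSign]; split_ifs <;> simp
  exact mul_ne_zero (mul_ne_zero h2 (pow_ne_zero _ h1))
    (by rw [← norm_ne_zero_iff, AddChar.norm_apply]; exact one_ne_zero) hc.symm

/-- Each value alone is `±√p^(m+s) ζ^c`; the common factor `u` forces a common sign. If one sign is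
`+`, then `u` is itself a power of `ζ` and all signs can be taken `+`. -/
lemma walsh_eq_of_mem (hp : p % 4 = 1) (hf : IsWeaklyRegular f s) {β : F}
    (hβ : β ∈ walshSupport f s) :
    walsh f β = (walshSign f s : ℂ) * ((√(p : ℝ) : ℝ) : ℂ) ^ (Module.finrank (ZMod p) F + s)
        * ZMod.stdAddChar (dualFun f s β) := by
  obtain ⟨hpl, u, -, g, -, hg⟩ := hf
  have hex (β : F) (hβ : β ∈ walshSupport f s) : ∃ c : ZMod p,
      walsh f β = ((√(p : ℝ) : ℝ) : ℂ) ^ (Module.finrank (ZMod p) F + s) * ZMod.stdAddChar c ∨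
      walsh f β = -(((√(p : ℝ) : ℝ) : ℂ) ^ (Module.finrank (ZMod p) F + s)
        * ZMod.stdAddChar c) :=
    exists_eq_sqrt_pow_mul_stdAddChar hp _ _ hβ
  have h : ∃ c : ZMod p, walsh f β = (walshSign f s : ℂ)
      * ((√(p : ℝ) : ℝ) : ℂ) ^ (Module.finrank (ZMod p) F + s) * ZMod.stdAddChar c := by
    rw [walshSign]
    split_ifs with h
    · obtain ⟨β₀, c, hc⟩ := h
      have hpos := (Fact.out : p.Prime).pos
      have h1 : ((√(p : ℝ) : ℝ) : ℂ) ≠ 0 := by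
        rw [Complex.ofReal_ne_zero]; positivity
      have hβ₀ : walsh f β₀ ≠ 0 := by
        rw [hc]
        exact mul_ne_zero (pow_ne_zero _ h1)
          (by rw [← norm_ne_zero_iff, AddChar.norm_apply]; exact one_ne_zero)
      have h2 := (hg β₀).resolve_left hβ₀
      have h3 := (hg β).resolve_left ((walsh_ne_zero_iff hpl).2 hβ)
      -- Comparing the two expressions at `β₀` gives `u = ζ^(c - g β₀)`.
      refine ⟨c - g β₀ + g β, ?_⟩
      have h5 : (ZMod.stdAddChar c : ℂ) = u * ZMod.stdAddChar (g β₀) := by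
        apply mul_left_cancel₀ (pow_ne_zero (Module.finrank (ZMod p) F + s) h1)
        rw [← hc, h2]
        ring
      rw [h3, AddChar.map_add_eq_mul, sub_eq_add_neg, AddChar.map_add_eq_mul,
        AddChar.map_neg_eq_inv]
      have h4 : (ZMod.stdAddChar (g β₀) : ℂ) ≠ 0 := by
        rw [← norm_ne_zero_iff, AddChar.norm_apply]; exact one_ne_zero
      field_simp
      push_cast
      linear_combination (-(ZMod.stdAddChar (g β) : ℂ)) * h5
    · obtain ⟨c, hc | hc⟩ := hex β hβ
      · exact absurd ⟨β, c, hc⟩ h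
      · exact ⟨c, by rw [hc]; push_cast; ring⟩
  rw [dualFun, dif_pos h]
  exact h.choose_spec

lemma exists_pow_eq_of_coprime {e : ℕ} (he : Nat.gcd e (p - 1) = 1) {z : ZMod p} (hz : z ≠ 0) :
    ∃ w : ZMod p, w ≠ 0 ∧ w ^ e = z := by
  have hc : (Nat.card (ZMod p)ˣ).Coprime e := by
    rw [Nat.card_eq_fintype_card, ZMod.card_units p]
    exact Nat.Coprime.symm he
  obtain ⟨w, hw⟩ := (powCoprime hc).surjective (Units.mk0 z hz)
  exact ⟨w, w.ne_zero, by simpa [powCoprime] using congrArg Units.val hw⟩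

/-- Conjugating by `w^h` and substituting `x ↦ w x` carries a zero of the transform at `β` to one at
`w^(h-1) β`. As `gcd(h-1, p-1) = 1`, every nonzero scalar is some `w^(h-1)`. -/
lemma smul_mem_walshSupport (hf : IsWRP f s) {z : ZMod p} (hz : z ≠ 0) {β : F}
    (hβ : β ∈ walshSupport f s) : z • β ∈ walshSupport f s := by
  obtain ⟨h, hpos, -, hgcd, hhom⟩ := hf.homogeneous
  have key : ∀ w : ZMod p, w ≠ 0 → ∀ β : F, walsh f β = 0 → walsh f (w ^ (h - 1) • β) = 0 := by
    intro w hw β hβ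
    have h1 := sum_stdAddChar_mul_eq (fun x : F => f x - Algebra.trace (ZMod p) F (β * x)) 0 0
      (by simpa [walsh] using hβ) (pow_ne_zero h hw)
    rw [Rat.cast_zero, zero_mul] at h1
    rw [walsh, ← h1]
    refine (Fintype.sum_equiv (LinearEquiv.smulOfNeZero (ZMod p) F w hw).toEquiv _ _ fun x => ?_).symm
    congr 1
    change _ = f (w • x) - Algebra.trace (ZMod p) F (w ^ (h - 1) • β * (w • x))
    rw [hhom w hw, smul_mul_smul_comm, ← pow_succ, Nat.sub_add_cancel hpos, map_smul, mul_sub,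
      smul_eq_mul]
  obtain ⟨w, hw, hwz⟩ := exists_pow_eq_of_coprime hgcd (inv_ne_zero hz)
  rw [← walsh_ne_zero_iff hf.weaklyRegular.1] at hβ ⊢
  intro h0
  refine hβ ?_
  have := key w hw _ h0
  rwa [hwz, smul_smul, inv_mul_cancel₀ hz, one_smul] at this

lemma zero_mem_walshSupport (hf : IsWRP f s) : (0 : F) ∈ walshSupport f s :=
  (walsh_ne_zero_iff hf.weaklyRegular.1).1 hf.unbalanced

/-- `z ^ ((p - 1) / 2)` is `-1` for some `z`. -/
lemma exists_pow_half_eq_neg_one (hp : p % 4 = 1) :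
    ∃ z : ZMod p, z ≠ 0 ∧ z ^ ((p - 1) / 2) = -1 := by
  have hp2 : ringChar (ZMod p) ≠ 2 := by rw [ZMod.ringChar_zmod_n]; omega
  obtain ⟨z, hz⟩ := FiniteField.exists_nonsquare hp2
  have hz0 : z ≠ 0 := by rintro rfl; exact hz ⟨0, by simp⟩
  have h2 : (p - 1) / 2 = p / 2 := by omega
  refine ⟨z, hz0, ?_⟩
  rw [h2]
  exact (ZMod.pow_div_two_eq_neg_one_or_one p hz0).resolve_left
    fun h => hz ((ZMod.euler_criterion p hz0).2 h)

lemma dualFun_smul (hf : IsWRP f s) {l : ℕ} (hl : IsIndex f s l) {z : ZMod p}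
    (hz : z ≠ 0) (β : F) : dualFun f s (z • β) = z ^ l * dualFun f s β := by
  by_cases hβ : β ∈ walshSupport f s
  · exact hl.2.2.2 z hz β hβ
  · rw [dualFun_of_notMem hf.weaklyRegular.1 hβ, dualFun_of_notMem hf.weaklyRegular.1, mul_zero]
    intro h
    refine hβ ?_
    have := smul_mem_walshSupport hf (inv_ne_zero hz) h
    rwa [smul_smul, inv_mul_cancel₀ hz, one_smul] at this

/-- A scalar with `z^((p-1)/2) = -1` fixes the point `0`, so `f*(0) = -f*(0)`. -/
lemma dualFun_zero (hp : p % 4 = 1) (hf : IsWRP f s) (hl : IsIndex f s ((p - 1) / 2)) :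
    dualFun f s 0 = 0 := by
  obtain ⟨z, hz, hz1⟩ := exists_pow_half_eq_neg_one hp
  have h := dualFun_smul hf hl hz 0
  rw [hz1, smul_zero, neg_one_mul, eq_neg_iff_add_eq_zero, ← two_mul] at h
  refine (mul_eq_zero.1 h).resolve_left fun h2 => ?_
  have : ((2 : ℕ) : ZMod p) = 0 := by exact_mod_cast h2
  rw [ZMod.natCast_eq_zero_iff] at this
  have := Nat.le_of_dvd (by norm_num) this
  have := (Fact.out : p.Prime).two_le
  omega

/-- If the dual of `f` has index `(p - 1) / 2`, then so has `f`. -/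
lemma map_smul_of_isIndex (hp : p % 4 = 1) (hf : IsWRP f s) (hl : IsIndex f s ((p - 1) / 2))
    {z : ZMod p} (hz : z ≠ 0) (x : F) : f (z • x) = z ^ ((p - 1) / 2) * f x := by
  classical
  have hpp : p.Prime := Fact.out
  set n := Module.finrank (ZMod p) F + s
  have hW (β : F) : walsh f β = if β ∈ walshSupport f s then
      (walshSign f s : ℂ) * ((√(p : ℝ) : ℝ) : ℂ) ^ n * ZMod.stdAddChar (dualFun f s β) else 0 := by
    split_ifs with h
    · exact walsh_eq_of_mem hp hf.weaklyRegular h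
    · exact (walsh_eq_zero_iff hf.weaklyRegular.1).2 h
  have hmem {w : ZMod p} (hw : w ≠ 0) (β : F) :
      w • β ∈ walshSupport f s ↔ β ∈ walshSupport f s := by
    refine ⟨fun h => ?_, smul_mem_walshSupport hf hw⟩
    have := smul_mem_walshSupport hf (inv_ne_zero hw) h
    rwa [smul_smul, inv_mul_cancel₀ hw, one_smul] at this
  have hq : (Fintype.card F : ℂ) ≠ 0 := by exact_mod_cast Fintype.card_ne_zero
  have h1 : ∑ β : F, walsh f (z⁻¹ • β) * ZMod.stdAddChar (Algebra.trace (ZMod p) F (β * x))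
      = Fintype.card F * ZMod.stdAddChar (f (z • x)) := by
    rw [← sum_walsh_mul f (z • x)]
    refine Fintype.sum_equiv
      (LinearEquiv.smulOfNeZero (ZMod p) F z⁻¹ (inv_ne_zero hz)).toEquiv _ _ fun β => ?_
    change _ = walsh f (z⁻¹ • β) * ZMod.stdAddChar (Algebra.trace (ZMod p) F ((z⁻¹ • β) * (z • x)))
    rw [smul_mul_smul_comm, inv_mul_cancel₀ hz, one_smul]
  have hinv : (z⁻¹) ^ ((p - 1) / 2) = (z ^ ((p - 1) / 2))⁻¹ := inv_pow _ _
  have h2 : (p - 1) / 2 = p / 2 := by omega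
  have hfin {a b : ZMod p} (h : (Fintype.card F : ℂ) * ZMod.stdAddChar a
      = Fintype.card F * ZMod.stdAddChar b) : a = b :=
    ZMod.injective_stdAddChar (mul_left_cancel₀ hq h)
  -- If `z` is a square, the transform is invariant under `z⁻¹`. Otherwise `z⁻¹` negates `f*`, which
  -- conjugates the Walsh values since their prefactor is real; conjugation of the inversion formula
  -- turns `x` into `-x`, and `f` is even.
  rcases ZMod.pow_div_two_eq_neg_one_or_one p hz with h3 | h3
  · rw [← h2] at h3
    rw [h3, one_mul]
    apply hfin
    rw [← h1, ← sum_walsh_mul f x]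
    refine Finset.sum_congr rfl fun β _ => ?_
    rw [hW, hW β, dualFun_smul hf hl (inv_ne_zero hz), hinv, h3, inv_one, one_mul]
    simp only [hmem (inv_ne_zero hz)]
  · rw [← h2] at h3
    rw [h3, neg_one_mul]
    apply hfin
    have hneg : f (-x) = f x := by
      obtain ⟨h, -, heven, -, hhom⟩ := hf.homogeneous
      have := hhom (-1) (neg_ne_zero.2 one_ne_zero) x
      rwa [heven.neg_one_pow, one_mul, neg_one_smul] at this
    rw [← h1, ← star_stdAddChar, ← hneg, ← Complex.conj_natCast, ← map_mul,
      ← sum_walsh_mul f (-x), map_sum]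
    refine Finset.sum_congr rfl fun β _ => ?_
    rw [hW, hW β, dualFun_smul hf hl (inv_ne_zero hz), hinv, h3, inv_neg_one, neg_one_mul]
    simp only [hmem (inv_ne_zero hz)]
    split_ifs
    · simp [star_stdAddChar, Complex.conj_ofReal]
    · simp

end Walsh

/-! ### Zero counts for a function with a rational Walsh dual -/

section DualPair

variable {p : ℕ} [Fact p.Prime] {V : Type*} [AddCommGroup V] [Module (ZMod p) V] [Fintype V]

/-- A function `H` on a finite quadratic space whose Walsh transform with respect to the
nondegenerate form `B` is `r ζ_p ^ (Hs a)` for `a ∈ S` and vanishes off `S`, where `S` is stable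
under scalars and `Hs` is homogeneous of degree `(p - 1) / 2`. -/
structure IsWalshDual (H Hs : V → ZMod p) (B : V →ₗ[ZMod p] V →ₗ[ZMod p] ZMod p)
    (S : Set V) (r : ℚ) : Prop where
  symm : ∀ a v, B a v = B v a
  nondeg : ∀ a, a ≠ 0 → ∃ v, B a v ≠ 0
  sum_mem : ∀ a ∈ S, ∑ v, (ZMod.stdAddChar (H v - B a v) : ℂ) = r * ZMod.stdAddChar (Hs a)
  sum_notMem : ∀ a ∉ S, ∑ v, (ZMod.stdAddChar (H v - B a v) : ℂ) = 0
  zero_mem : (0 : V) ∈ S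
  smul_mem : ∀ z : ZMod p, z ≠ 0 → ∀ a ∈ S, z • a ∈ S
  map_zero : H 0 = 0
  dual_smul : ∀ z : ZMod p, z ≠ 0 → ∀ a, Hs (z • a) = z ^ ((p - 1) / 2) * Hs a
  dual_zero : Hs 0 = 0
  ne_zero : r ≠ 0

open Classical in
lemma sum_stdAddChar_mul (c : ZMod p) :
    ∑ y : ZMod p, (ZMod.stdAddChar (y * c) : ℂ) = if c = 0 then (p : ℂ) else 0 := by
  have := AddChar.sum_mulShift (ψ := (ZMod.stdAddChar : AddChar (ZMod p) ℂ)) c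
    (ZMod.isPrimitive_stdAddChar p)
  rw [this, ZMod.card]
  split_ifs <;> simp

open Classical in
lemma sum_erase_stdAddChar_mul (c : ZMod p) :
    ∑ y ∈ Finset.univ.erase (0 : ZMod p), (ZMod.stdAddChar (y * c) : ℂ)
      = (if c = 0 then (p : ℂ) else 0) - 1 := by
  rw [← sum_stdAddChar_mul c, ← Finset.add_sum_erase _ _ (Finset.mem_univ (0 : ZMod p))]
  simp

namespace IsWalshDual

variable {H Hs : V → ZMod p} {B : V →ₗ[ZMod p] V →ₗ[ZMod p] ZMod p} {S : Set V} {r : ℚ}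

open Classical in
lemma sum_form (h : IsWalshDual H Hs B S r) (a : V) :
    ∑ v, (ZMod.stdAddChar (B a v) : ℂ) = if a = 0 then (Fintype.card V : ℂ) else 0 := by
  split_ifs with ha
  · simp [ha]
  · let χ : AddChar V ℂ :=
      { toFun v := ZMod.stdAddChar (B a v)
        map_zero_eq_one' := by simp
        map_add_eq_mul' x y := by rw [map_add, AddChar.map_add_eq_mul] }
    refine AddChar.sum_eq_zero_of_ne_one (ψ := χ) fun h1 => ?_
    obtain ⟨x, hx⟩ := h.nondeg a ha
    refine hx (ZMod.injective_stdAddChar ?_)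
    rw [AddChar.map_zero_eq_one]
    exact DFunLike.congr_fun h1 x

open Classical in
lemma sum_scaled (h : IsWalshDual H Hs B S r) (a : V) {y : ZMod p} (hy : y ≠ 0) :
    ∑ v, (ZMod.stdAddChar (y * (H v - B a v)) : ℂ)
      = if a ∈ S then (r : ℂ) * ZMod.stdAddChar (y * Hs a) else 0 := by
  split_ifs with ha
  · exact sum_stdAddChar_mul_eq _ r _ (h.sum_mem a ha) hy
  · have := sum_stdAddChar_mul_eq (fun v => H v - B a v) 0 0
      (by simpa using h.sum_notMem a ha) hy
    simpa using this

open Classical in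
/-- The number of zeros of `H`. -/
lemma card_zeros (h : IsWalshDual H Hs B S r) :
    (p : ℚ) * (Finset.univ.filter fun v => H v = 0).card
      = Fintype.card V + ((p : ℚ) - 1) * r := by
  have key : (p : ℂ) * (Finset.univ.filter fun v => H v = 0).card
      = Fintype.card V + ((p : ℂ) - 1) * r := by
    -- `1 + ∑_{y ≠ 0} ζ^(y c)` is `p` if `c = 0` and `0` otherwise.
    have h1 : (p : ℂ) * (Finset.univ.filter fun v => H v = 0).card
        = ∑ v, ((∑ y ∈ Finset.univ.erase (0 : ZMod p), (ZMod.stdAddChar (y * H v) : ℂ)) + 1) := by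
      simp_rw [sum_erase_stdAddChar_mul, sub_add_cancel]
      rw [← Finset.sum_filter, Finset.sum_const, nsmul_eq_mul, mul_comm]
    rw [h1, Finset.sum_add_distrib, Finset.sum_comm]
    have h2 : ∀ y ∈ Finset.univ.erase (0 : ZMod p),
        ∑ v, (ZMod.stdAddChar (y * H v) : ℂ) = r * ZMod.stdAddChar (y * 0) := by
      intro y hy
      have := h.sum_scaled 0 (Finset.ne_of_mem_erase hy)
      simpa [h.zero_mem, h.dual_zero] using this
    rw [Finset.sum_congr rfl h2, ← Finset.mul_sum, sum_erase_stdAddChar_mul]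
    simp
    ring
  exact_mod_cast key

open Classical in
-- Both conditions are detected by character sums. The terms with `y = 0` give `|V|` by
-- orthogonality. For `y ≠ 0` the variable dual to `B a v` is rescaled by `-y`, so that each term is
-- the `y`-conjugate of the transform at `z a`.
lemma card_zeros_form_aux (h : IsWalshDual H Hs B S r) {a : V} (ha : a ≠ 0) :
    (p : ℂ) ^ 2 * (Finset.univ.filter fun v => H v = 0 ∧ B a v = 0).card
      = Fintype.card V + ∑ z : ZMod p, ∑ y ∈ Finset.univ.erase (0 : ZMod p),
          if z • a ∈ S then (r : ℂ) * ZMod.stdAddChar (y * Hs (z • a)) else 0 := by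
  have hpt (v : V) : (if H v = 0 ∧ B a v = 0 then (p : ℂ) ^ 2 else 0)
      = (∑ z : ZMod p, (ZMod.stdAddChar (z * B a v) : ℂ))
        + ∑ y ∈ Finset.univ.erase (0 : ZMod p), ∑ z : ZMod p,
          (ZMod.stdAddChar (y * (H v - B (z • a) v)) : ℂ) := by
    have e (y z : ZMod p) : (ZMod.stdAddChar (y * (H v - B (z • a) v)) : ℂ)
        = ZMod.stdAddChar (y * H v) * ZMod.stdAddChar (z * (-(y * B a v))) := by
      rw [← AddChar.map_add_eq_mul, map_smul, LinearMap.smul_apply, smul_eq_mul]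
      congr 1
      ring
    simp_rw [e, ← Finset.mul_sum, sum_stdAddChar_mul]
    by_cases hB : B a v = 0
    · simp only [hB, mul_zero, neg_zero, if_true, and_true, ← Finset.sum_mul,
        sum_erase_stdAddChar_mul]
      split_ifs <;> ring
    · rw [if_neg (fun hh => hB hh.2), if_neg hB, zero_add]
      refine (Finset.sum_eq_zero fun y hy => ?_).symm
      rw [if_neg, mul_zero]
      exact neg_ne_zero.2 (mul_ne_zero (Finset.ne_of_mem_erase hy) hB)
  have h0 : (p : ℂ) ^ 2 * (Finset.univ.filter fun v => H v = 0 ∧ B a v = 0).card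
      = ∑ v, (if H v = 0 ∧ B a v = 0 then (p : ℂ) ^ 2 else 0) := by
    rw [← Finset.sum_filter, Finset.sum_const, nsmul_eq_mul, mul_comm]
  have h1 : ∑ v, ∑ z : ZMod p, (ZMod.stdAddChar (z * B a v) : ℂ) = Fintype.card V := by
    rw [Finset.sum_comm]
    have (z : ZMod p) : ∑ v, (ZMod.stdAddChar (z * B a v) : ℂ)
        = if z = 0 then (Fintype.card V : ℂ) else 0 := by
      have := h.sum_form (z • a)
      simpa [smul_eq_zero, ha] using this
    simp_rw [this]
    simp
  rw [h0]
  simp_rw [hpt]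
  rw [Finset.sum_add_distrib, h1]
  congr 1
  rw [Finset.sum_comm, Finset.sum_comm (s := Finset.univ) (t := Finset.univ.erase 0)]
  refine Finset.sum_congr rfl fun y hy => ?_
  rw [Finset.sum_comm]
  exact Finset.sum_congr rfl fun z _ => h.sum_scaled (z • a) (Finset.ne_of_mem_erase hy)

lemma smul_mem_iff (h : IsWalshDual H Hs B S r) {z : ZMod p} (hz : z ≠ 0) {a : V} :
    z • a ∈ S ↔ a ∈ S := by
  refine ⟨fun h1 => ?_, h.smul_mem z hz a⟩
  have := h.smul_mem z⁻¹ (inv_ne_zero hz) _ h1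
  rwa [smul_smul, inv_mul_cancel₀ hz, one_smul] at this

open Classical in
-- The line through `a` meets `S` only in `0`, so only `z = 0` survives.
lemma card_zeros_form_of_notMem (h : IsWalshDual H Hs B S r) {a : V} (ha : a ∉ S) :
    (p : ℚ) ^ 2 * (Finset.univ.filter fun v => H v = 0 ∧ B a v = 0).card
      = Fintype.card V + ((p : ℚ) - 1) * r := by
  have ha0 : a ≠ 0 := fun h0 => ha (h0 ▸ h.zero_mem)
  have h1 := h.card_zeros_form_aux ha0
  rw [Finset.sum_eq_single 0] at h1
  · simp only [zero_smul, h.zero_mem, if_true, h.dual_zero, ← Finset.mul_sum,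
      sum_erase_stdAddChar_mul] at h1
    rw [mul_comm (r : ℂ)] at h1
    exact_mod_cast h1
  · intro z _ hz
    simp [h.smul_mem_iff hz, ha]
  · simp

open Classical in
-- The whole line lies in `S`, and `z` contributes `(p-1) r` or `-r` according as `Hs (z a)`
-- vanishes or not. If `Hs a ≠ 0`, the term `z = 0` cancels the `p - 1` others.
lemma card_zeros_form_of_mem (h : IsWalshDual H Hs B S r) {a : V} (ha : a ∈ S) (ha0 : a ≠ 0) :
    (p : ℚ) ^ 2 * (Finset.univ.filter fun v => H v = 0 ∧ B a v = 0).card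
      = Fintype.card V + if Hs a = 0 then (p : ℚ) * ((p : ℚ) - 1) * r else 0 := by
  have h1 := h.card_zeros_form_aux ha0
  have hm (z : ZMod p) : z • a ∈ S := by
    by_cases hz : z = 0
    · rw [hz, zero_smul]; exact h.zero_mem
    · exact h.smul_mem z hz a ha
  have hd (z : ZMod p) : Hs (z • a) = 0 ↔ Hs a = 0 ∨ z = 0 := by
    by_cases hz : z = 0
    · simp [hz, h.dual_zero]
    · simp [h.dual_smul z hz, hz]
  simp only [hm, if_true, ← Finset.mul_sum, sum_erase_stdAddChar_mul, hd,
    Finset.sum_sub_distrib] at h1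
  split_ifs with h2
  · simp only [h2, true_or, if_true, Finset.sum_const, Finset.card_univ, ZMod.card,
      nsmul_eq_mul, mul_one] at h1
    have h3 : (p : ℂ) ^ 2 * (Finset.univ.filter fun v => H v = 0 ∧ B a v = 0).card
      = Fintype.card V + (p : ℂ) * ((p : ℂ) - 1) * r := by rw [h1]; ring
    exact_mod_cast h3
  · simp only [h2, false_or, Finset.sum_ite_eq', Finset.mem_univ, if_true, Finset.sum_const,
      Finset.card_univ, ZMod.card, nsmul_eq_mul, mul_one, sub_self, mul_zero] at h1
    exact_mod_cast h1

open Classical in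
/-- The number of zeros of the dual function on the Walsh support. -/
lemma card_dual_zeros (h : IsWalshDual H Hs B S r) :
    (p : ℚ) * (Finset.univ.filter fun a => a ∈ S ∧ Hs a = 0).card
      = (Finset.univ.filter fun a => a ∈ S).card + ((p : ℚ) - 1) * (Fintype.card V / r) := by
  have hr : (r : ℂ) ≠ 0 := by exact_mod_cast h.ne_zero
  -- Inversion at `0`, where `H 0 = 0`. The value is again rational, so conjugation applies to `Hs`
  -- as it did to `H`.
  have h1 : ∑ a : S, (ZMod.stdAddChar (Hs a) : ℂ)
      = ((Fintype.card V / r : ℚ) : ℂ) * ZMod.stdAddChar (0 : ZMod p) := by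
    have h2 : (r : ℂ) * ∑ a : S, (ZMod.stdAddChar (Hs a) : ℂ)
        = ∑ a, ∑ v, (ZMod.stdAddChar (H v - B a v) : ℂ) := by
      rw [← Finset.sum_subtype (Finset.univ.filter fun a => a ∈ S) (by simp)
        (fun a => (ZMod.stdAddChar (Hs a) : ℂ)), Finset.sum_filter, Finset.mul_sum]
      refine Finset.sum_congr rfl fun a _ => ?_
      split_ifs with ha
      · exact (h.sum_mem a ha).symm
      · rw [mul_zero, h.sum_notMem a ha]
    have h3 : ∑ a, ∑ v, (ZMod.stdAddChar (H v - B a v) : ℂ) = Fintype.card V := by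
      rw [Finset.sum_comm]
      have (v : V) : ∑ a, (ZMod.stdAddChar (H v - B a v) : ℂ)
          = ZMod.stdAddChar (H v) * if v = 0 then (Fintype.card V : ℂ) else 0 := by
        rw [show (if v = 0 then (Fintype.card V : ℂ) else 0)
          = if -v = 0 then (Fintype.card V : ℂ) else 0 by simp, ← h.sum_form (-v), Finset.mul_sum]
        refine Finset.sum_congr rfl fun a _ => ?_
        rw [← AddChar.map_add_eq_mul, map_neg, LinearMap.neg_apply, h.symm v a, sub_eq_add_neg]
      simp_rw [this]
      simp [h.map_zero]
    rw [AddChar.map_zero_eq_one, mul_one]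
    push_cast
    rw [eq_div_iff hr, mul_comm, h2, h3]
  have h2 : (p : ℂ) * (Finset.univ.filter fun a => a ∈ S ∧ Hs a = 0).card
      = ∑ a : S, ((∑ y ∈ Finset.univ.erase (0 : ZMod p), (ZMod.stdAddChar (y * Hs a) : ℂ)) + 1) := by
    simp_rw [sum_erase_stdAddChar_mul, sub_add_cancel]
    rw [← Finset.sum_subtype (Finset.univ.filter fun a => a ∈ S) (by simp)
        (fun a => if Hs a = 0 then (p : ℂ) else 0), ← Finset.sum_filter, Finset.filter_filter,
        Finset.sum_const, nsmul_eq_mul, mul_comm]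
  rw [Finset.sum_add_distrib, Finset.sum_comm, Finset.sum_congr rfl fun y hy =>
    sum_stdAddChar_mul_eq _ _ _ h1 (Finset.ne_of_mem_erase hy), ← Finset.mul_sum,
    sum_erase_stdAddChar_mul] at h2
  have h4 : (p : ℂ) * (Finset.univ.filter fun a => a ∈ S ∧ Hs a = 0).card
      = (Finset.univ.filter fun a => a ∈ S).card
        + ((p : ℂ) - 1) * ((Fintype.card V / r : ℚ) : ℂ) := by
    rw [h2, Finset.sum_const, Finset.card_univ, Fintype.card_subtype, if_pos rfl, nsmul_eq_mul]
    ring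
  exact_mod_cast h4

end IsWalshDual

end DualPair

/-! ### Representatives of scalar orbits and projectivity -/

section Puncturing

variable {p : ℕ} [Fact p.Prime] {F : Type*} [Field F] [Fintype F] [Algebra (ZMod p) F]

lemma exists_isPuncturing {D : Set (F × F)} (h0 : (0 : F × F) ∉ D)
    (hD : ∀ z : ZMod p, z ≠ 0 → ∀ v ∈ D, z • v ∈ D) : ∃ E : Finset (F × F), IsPuncturing p D E := by
  classical
  let rep (v : F × F) : F × F := (Quotient.mk (MulAction.orbitRel (ZMod p)ˣ (F × F)) v).out
  have hrep (v : F × F) : ∃ z : (ZMod p)ˣ, (z : ZMod p) • v = rep v := by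
    have := Quotient.mk_out (s := MulAction.orbitRel (ZMod p)ˣ (F × F)) v
    exact this
  have hrep_smul (z : (ZMod p)ˣ) (v : F × F) : rep ((z : ZMod p) • v) = rep v := by
    have : (Quotient.mk (MulAction.orbitRel (ZMod p)ˣ (F × F)) ((z : ZMod p) • v))
        = Quotient.mk (MulAction.orbitRel (ZMod p)ˣ (F × F)) v := Quotient.sound ⟨z, rfl⟩
    simp only [rep, this]
  refine ⟨Finset.univ.filter fun v => v ∈ D ∧ rep v = v, ?_, ?_⟩
  · ext v
    simp only [Finset.coe_filter, Finset.mem_univ, true_and, Set.mem_iUnion, Set.mem_image,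
      Set.mem_ofPred_eq]
    constructor
    · rintro ⟨z, w, ⟨hw, -⟩, rfl⟩
      exact hD z z.ne_zero w hw
    · intro hv
      obtain ⟨z, hz⟩ := hrep v
      refine ⟨z⁻¹, rep v, ⟨?_, ?_⟩, ?_⟩
      · rw [← hz]; exact hD z z.ne_zero v hv
      · rw [← hz, hrep_smul]; exact hz.symm
      · rw [← hz, smul_smul, Units.inv_mul, one_smul]
  · intro z w hzw
    rw [Set.disjoint_left]
    rintro _ ⟨v, hv, rfl⟩ ⟨v', hv', h⟩
    simp only [Finset.coe_filter, Finset.mem_univ, true_and, Set.mem_ofPred_eq] at hv hv' h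
    have h1 : v' = v := by
      rw [← hv.2, ← hv'.2, ← hrep_smul w v', h, hrep_smul]
    subst h1
    have h2 : ((w : ZMod p) - z) • v' = 0 := by rw [sub_smul, h, sub_self]
    rcases smul_eq_zero.1 h2 with h3 | h3
    · exact hzw (Units.ext (sub_eq_zero.1 h3).symm)
    · exact h0 (h3 ▸ hv.1)

/-- Scaling `(z, v) ↦ z v` is a bijection from units times `E` onto `D`, and `P` is scale invariant.
-/
lemma IsPuncturing.card_filter {D : Set (F × F)} {E : Finset (F × F)} (hE : IsPuncturing p D E)
    {P : F × F → Prop} [DecidablePred P] [DecidablePred fun v => v ∈ D ∧ P v]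
    (hP : ∀ z : ZMod p, z ≠ 0 → ∀ v, P (z • v) ↔ P v) :
    (p - 1) * (E.filter P).card = (Finset.univ.filter fun v => v ∈ D ∧ P v).card := by
  classical
  obtain ⟨hU, hdis⟩ := hE
  rw [← ZMod.card_units p, ← Finset.card_univ, ← Finset.card_product]
  refine Finset.card_bij (fun x _ => (x.1 : ZMod p) • x.2) ?_ ?_ ?_
  · rintro ⟨z, v⟩ hx
    simp only [Finset.mem_product, Finset.mem_univ, true_and, Finset.mem_filter] at hx ⊢
    refine ⟨?_, (hP z z.ne_zero v).2 hx.2⟩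
    rw [← hU]
    exact Set.mem_iUnion.2 ⟨z, v, hx.1, rfl⟩
  · rintro ⟨z, v⟩ hx ⟨w, v'⟩ hx' h
    simp only [Finset.mem_product, Finset.mem_univ, true_and, Finset.mem_filter] at hx hx' h
    have hzw : z = w := by
      by_contra hne
      exact Set.disjoint_left.1 (hdis hne) ⟨v, hx.1, rfl⟩ ⟨v', hx'.1, h.symm⟩
    subst hzw
    rw [smul_right_injective _ z.ne_zero h]
  · intro v hv
    simp only [Finset.mem_filter, Finset.mem_univ, true_and] at hv
    rw [← hU] at hv
    obtain ⟨z, w, hw, rfl⟩ := Set.mem_iUnion.1 hv.1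
    exact ⟨(z, w), by simpa using ⟨hw, (hP z z.ne_zero w).1 hv.2⟩, rfl⟩

lemma IsPuncturing.mem {D : Set (F × F)} {E : Finset (F × F)} (hE : IsPuncturing p D E)
    {v : F × F} (hv : v ∈ E) : v ∈ D := by
  rw [← hE.1]
  exact Set.mem_iUnion.2 ⟨1, v, hv, by simp⟩

lemma IsPuncturing.eq_of_smul_mem {D : Set (F × F)} {E : Finset (F × F)}
    (hE : IsPuncturing p D E) {v : F × F} {z : ZMod p} (hz : z ≠ 0) (hv : v ∈ E)
    (hzv : z • v ∈ E) : z • v = v := by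
  by_contra hne
  have h1 : Units.mk0 z hz ≠ 1 := by
    rintro h
    have : z = 1 := congrArg Units.val h
    exact hne (by rw [this, one_smul])
  exact Set.disjoint_left.1 (hE.2 h1) ⟨v, hv, rfl⟩ ⟨z • v, hzv, by simp⟩

/-- The bilinear form `((a, b), (x, y)) ↦ Tr (a x + b y)`. -/
def pairForm (p : ℕ) [Fact p.Prime] (F : Type*) [Field F] [Fintype F] [Algebra (ZMod p) F] :
    (F × F) →ₗ[ZMod p] (F × F) →ₗ[ZMod p] ZMod p :=
  (Algebra.traceForm (ZMod p) F).compl₁₂ (LinearMap.fst (ZMod p) F F) (LinearMap.fst (ZMod p) F F)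
  + (Algebra.traceForm (ZMod p) F).compl₁₂ (LinearMap.snd (ZMod p) F F)
    (LinearMap.snd (ZMod p) F F)

lemma pairForm_apply (a v : F × F) : pairForm p F a v
    = Algebra.trace (ZMod p) F (a.1 * v.1) + Algebra.trace (ZMod p) F (a.2 * v.2) := rfl

lemma codeMap_apply (E : Finset (F × F)) (a : F × F) (v : E) :
    codeMap p E a v = pairForm p F a v := by
  rw [pairForm_apply, ← map_add]; rfl

lemma pairForm_symm (a v : F × F) : pairForm p F a v = pairForm p F v a := by
  simp only [pairForm_apply, mul_comm]

lemma pairForm_nondeg {a : F × F} (ha : a ≠ 0) : ∃ v, pairForm p F a v ≠ 0 := by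
  by_cases h : a.1 = 0
  · have h2 : a.2 ≠ 0 := fun h2 => ha (Prod.ext h h2)
    obtain ⟨x, hx⟩ := exists_trace_mul_ne_zero (p := p) h2
    exact ⟨(0, x), by simpa [pairForm_apply] using hx⟩
  · obtain ⟨x, hx⟩ := exists_trace_mul_ne_zero (p := p) h
    exact ⟨(x, 0), by simpa [pairForm_apply] using hx⟩

lemma hammingNorm_codeMap (E : Finset (F × F)) (a : F × F) :
    hammingNorm (codeMap p E a) = (E.filter fun v => pairForm p F a v ≠ 0).card := by
  classical
  rw [hammingNorm]
  simp_rw [codeMap_apply]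
  rw [← Finset.card_map (Function.Embedding.subtype _)]
  congr 1
  ext v
  simp
  tauto

/-- By nondegeneracy a dual codeword is a linear relation among the points of `E`. A relation with
one or two terms would produce a zero point or two proportional points. -/
lemma isProjective_code {D : Set (F × F)} (h0 : (0 : F × F) ∉ D) {E : Finset (F × F)}
    (hE : IsPuncturing p D E) : IsProjective (code p E) := by
  classical
  refine le_iInf₂ fun w hw => ?_
  obtain ⟨hw, hw0⟩ := hw
  have hsum : ∑ i : E, w i • (i : F × F) = 0 := by
    by_contra hne
    obtain ⟨a, ha⟩ := pairForm_nondeg (p := p) hne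
    apply ha
    rw [pairForm_symm, map_sum]
    rw [← hw (codeMap p E a) ⟨a, rfl⟩]
    simp only [map_smul, smul_eq_mul, codeMap_apply]
  by_contra! hlt
  have hlt' : hammingNorm w < 3 := by exact_mod_cast hlt
  have hpos : 0 < hammingNorm w := hammingNorm_pos_iff.2 hw0
  have hsum' : ∑ i ∈ Finset.univ.filter (fun i => w i ≠ 0), w i • (i : F × F) = 0 := by
    rw [← hsum]
    refine Finset.sum_subset (Finset.subset_univ _) fun i _ hi => ?_
    have : w i = 0 := by simpa using hi
    rw [this, zero_smul]
  have hmem (i : E) : (i : F × F) ≠ 0 := fun h => h0 (h ▸ hE.mem i.2)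
  obtain h1 | h2 : hammingNorm w = 1 ∨ hammingNorm w = 2 := by omega
  · obtain ⟨i, hi⟩ := Finset.card_eq_one.1 h1
    have hwi : w i ≠ 0 := by
      have : i ∈ Finset.univ.filter (fun i => w i ≠ 0) := hi ▸ Finset.mem_singleton_self i
      simpa using this
    rw [hi, Finset.sum_singleton] at hsum'
    exact smul_ne_zero hwi (hmem i) hsum'
  · obtain ⟨i, j, hij, hi⟩ := Finset.card_eq_two.1 h2
    have hwi : w i ≠ 0 := by
      have : i ∈ Finset.univ.filter (fun i => w i ≠ 0) := hi ▸ by simp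
      simpa using this
    have hwj : w j ≠ 0 := by
      have : j ∈ Finset.univ.filter (fun i => w i ≠ 0) := hi ▸ by simp
      simpa using this
    rw [hi, Finset.sum_pair hij] at hsum'
    have hji : (-(w j)⁻¹ * w i) • (i : F × F) = j := by
      rw [neg_mul, neg_smul, mul_smul, eq_neg_of_add_eq_zero_left hsum', smul_neg, neg_neg,
        smul_smul, inv_mul_cancel₀ hwj, one_smul]
    have := hE.eq_of_smul_mem (mul_ne_zero (neg_ne_zero.2 (inv_ne_zero hwj)) hwi) i.2
      (by rw [hji]; exact j.2)
    rw [hji] at this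
    exact hij (Subtype.ext this.symm)

end Puncturing

/-! ### The pair `(f, g)`: length and weights of the punctured code -/

section WalshPair

variable {p : ℕ} [Fact p.Prime] {F : Type*} [Field F] [Fintype F] [Algebra (ZMod p) F]
  {f g : F → ZMod p} {s t : ℕ}

lemma sum_pairForm (f g : F → ZMod p) (a : F × F) :
    ∑ v : F × F, (ZMod.stdAddChar (f v.1 + g v.2 - pairForm p F a v) : ℂ)
      = walsh f a.1 * walsh g a.2 := by
  rw [walsh, walsh, Finset.sum_mul_sum, Fintype.sum_prod_type]
  refine Finset.sum_congr rfl fun x _ => Finset.sum_congr rfl fun y _ => ?_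
  rw [← AddChar.map_add_eq_mul, pairForm_apply]
  congr 1
  ring

/-- The evenness of `s + t` makes `√p^(m+s) √p^(m+t) = p^(m+k)` rational. -/
lemma isWalshDual (hp : p % 4 = 1) {m k : ℕ} (hF : Module.finrank (ZMod p) F = m)
    (hf : IsWRP f s) (hg : IsWRP g t) (hlf : IsIndex f s ((p - 1) / 2))
    (hlg : IsIndex g t ((p - 1) / 2)) (hst : s + t = k + k) :
    IsWalshDual (fun v : F × F => f v.1 + g v.2)
      (fun v => dualFun f s v.1 + dualFun g t v.2) (pairForm p F)
      (walshSupport f s ×ˢ walshSupport g t)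
      (((walshSign f s * walshSign g t : ℤ) : ℚ) * (p : ℚ) ^ (m + k)) where
  symm := pairForm_symm
  nondeg a ha := pairForm_nondeg ha
  sum_mem a ha := by
    have hsq : ((√(p : ℝ) : ℝ) : ℂ) ^ (m + s) * ((√(p : ℝ) : ℝ) : ℂ) ^ (m + t)
        = (p : ℂ) ^ (m + k) := by
      rw [← pow_add, show m + s + (m + t) = 2 * (m + k) by omega, pow_mul, ← Complex.ofReal_pow,
        Real.sq_sqrt (Nat.cast_nonneg p), Complex.ofReal_natCast]
    rw [sum_pairForm, walsh_eq_of_mem hp hf.weaklyRegular ha.1,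
      walsh_eq_of_mem hp hg.weaklyRegular ha.2, hF, AddChar.map_add_eq_mul]
    push_cast
    rw [← hsq]
    ring
  sum_notMem a ha := by
    rw [sum_pairForm, mul_eq_zero, walsh_eq_zero_iff hf.weaklyRegular.1,
      walsh_eq_zero_iff hg.weaklyRegular.1]
    by_contra! h
    exact ha h
  zero_mem := ⟨zero_mem_walshSupport hf, zero_mem_walshSupport hg⟩
  smul_mem z hz a ha := ⟨smul_mem_walshSupport hf hz ha.1, smul_mem_walshSupport hg hz ha.2⟩
  map_zero := by simp [hf.map_zero, hg.map_zero]
  dual_smul z hz a := by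
    simp only [Prod.smul_fst, Prod.smul_snd, dualFun_smul hf hlf hz, dualFun_smul hg hlg hz]
    ring
  dual_zero := by simp [dualFun_zero hp hf hlf, dualFun_zero hp hg hlg]
  ne_zero := by
    have := (Fact.out : p.Prime).pos
    have h1 : ((walshSign f s * walshSign g t : ℤ) : ℚ) ≠ 0 := by
      rw [walshSign, walshSign]; split_ifs <;> simp
    positivity

lemma card_walshSupport_prod {m k : ℕ} (hF : Module.finrank (ZMod p) F = m)
    (hf : IsPlateaued f s) (hg : IsPlateaued g t) (hst : s + t = k + k) :
    k ≤ m ∧ (walshSupport f s ×ˢ walshSupport g t).ncard = p ^ (2 * (m - k)) := by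
  have hp := (Fact.out : p.Prime).pos
  have h1 := hf.1
  have h2 := hg.1
  refine ⟨by omega, ?_⟩
  have h3 := ncard_walshSupport hf
  have h4 := ncard_walshSupport hg
  rw [hF] at h1 h2 h3 h4
  rw [Set.ncard_prod]
  apply Nat.eq_of_mul_eq_mul_right (Nat.pow_pos (n := s + t) hp)
  rw [← pow_add, show 2 * (m - k) + (s + t) = m + m by omega, pow_add, pow_add]
  nth_rw 1 [← h3]
  rw [← h4]
  ring

/-- The degrees `h` of `f` and `g` may differ; the common degree `(p-1)/2` coming from the indices
is what makes `f + g` homogeneous. -/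
lemma definingSet_smul (hp : p % 4 = 1) (hf : IsWRP f s) (hg : IsWRP g t)
    (hlf : IsIndex f s ((p - 1) / 2)) (hlg : IsIndex g t ((p - 1) / 2)) (z : ZMod p)
    (hz : z ≠ 0) (v : F × F) (hv : v ∈ definingSet f g) : z • v ∈ definingSet f g := by
  refine ⟨smul_ne_zero hz hv.1, ?_⟩
  rw [Prod.smul_fst, Prod.smul_snd, map_smul_of_isIndex hp hf hlf hz,
    map_smul_of_isIndex hp hg hlg hz, ← mul_add, hv.2, mul_zero]

variable {Hs : F × F → ZMod p} {S : Set (F × F)} {r : ℚ} {E : Finset (F × F)}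

lemma card_puncturing
    (h : IsWalshDual (fun v : F × F => f v.1 + g v.2) Hs (pairForm p F) S r)
    (hE : IsPuncturing p (definingSet f g) E) :
    (p : ℚ) * (((p : ℚ) - 1) * E.card) = Fintype.card (F × F) + ((p : ℚ) - 1) * r - p := by
  classical
  have h1 := hE.card_filter (P := fun _ => True) (by simp)
  -- The `1` accounts for the origin, a zero of `H` outside `D`.
  have h2 : (Finset.univ.filter fun v : F × F => v ∈ definingSet f g ∧ True).card + 1
      = (Finset.univ.filter fun v : F × F => f v.1 + g v.2 = 0).card := by
    have h0 : (0 : F × F) ∈ Finset.univ.filter fun v : F × F => f v.1 + g v.2 = 0 := by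
      simpa using h.map_zero
    rw [← Finset.card_erase_add_one h0]
    congr 2
    ext v
    simp [definingSet]
  rw [← h1, Finset.filter_true] at h2
  have h3 := h.card_zeros
  rw [← h2] at h3
  push_cast [(Fact.out : p.Prime).one_le] at h3
  linear_combination h3

/-- Zeros of `H` split by the hyperplane `B a v = 0`; the origin lies on it, so here it needs no
correction. -/
lemma hammingNorm_codeMap_mul (E : Finset (F × F))
    (hE : IsPuncturing p (definingSet f g) E) (a : F × F) :
    open Classical in
    (p - 1) * hammingNorm (codeMap p E a)
      + (Finset.univ.filter fun v : F × F => f v.1 + g v.2 = 0 ∧ pairForm p F a v = 0).card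
      = (Finset.univ.filter fun v : F × F => f v.1 + g v.2 = 0).card := by
  classical
  rw [hammingNorm_codeMap, hE.card_filter fun z hz v => by simp [hz]]
  rw [← Finset.card_filter_add_card_filter_not (s := Finset.univ.filter fun v : F × F =>
    f v.1 + g v.2 = 0) (fun v => pairForm p F a v = 0), add_comm, Finset.filter_filter,
    Finset.filter_filter]
  refine congrArg₂ _ rfl (congrArg Finset.card (Finset.ext fun v => ?_))
  simp only [Finset.mem_filter, Finset.mem_univ, true_and]
  simp only [definingSet, Set.mem_ofPred_eq]
  constructor
  · rintro ⟨⟨-, h1⟩, h2⟩; exact ⟨h1, h2⟩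
  · rintro ⟨h1, h2⟩
    refine ⟨⟨?_, h1⟩, h2⟩
    rintro rfl
    simp at h2

open Classical in
/-- The weight of a codeword of a punctured code. -/
lemma hammingNorm_codeMap_eq
    (h : IsWalshDual (fun v : F × F => f v.1 + g v.2) Hs (pairForm p F) S r)
    (hE : IsPuncturing p (definingSet f g) E) {a : F × F} (ha : a ≠ 0) :
    (p : ℚ) ^ 2 * hammingNorm (codeMap p E a) = Fintype.card (F × F) +
      if a ∈ S then if Hs a = 0 then 0 else p * r else ((p : ℚ) - 1) * r := by
  have h1 := hammingNorm_codeMap_mul E hE a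
  have h2 := h.card_zeros
  have h3 : ((p : ℚ) - 1) * hammingNorm (codeMap p E a)
      + (Finset.univ.filter fun v : F × F => f v.1 + g v.2 = 0 ∧ pairForm p F a v = 0).card
      = (Finset.univ.filter fun v : F × F => f v.1 + g v.2 = 0).card := by
    rw [← h1]; push_cast [(Fact.out : p.Prime).one_le]; ring
  have hp1 : ((p : ℚ) - 1) ≠ 0 := by
    have : (1 : ℚ) < p := by exact_mod_cast (Fact.out : p.Prime).one_lt
    linarith
  apply mul_left_cancel₀ hp1
  split_ifs with h4 h5
  · have h6 := h.card_zeros_form_of_mem h4 ha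
    rw [if_pos h5] at h6
    linear_combination (p : ℚ) ^ 2 * h3 + p * h2 - h6
  · have h6 := h.card_zeros_form_of_mem h4 ha
    rw [if_neg h5] at h6
    linear_combination (p : ℚ) ^ 2 * h3 + p * h2 - h6
  · have h6 := h.card_zeros_form_of_notMem h4
    linear_combination (p : ℚ) ^ 2 * h3 + p * h2 - h6

end WalshPair

/-! ### Weight distributions of images of injective linear maps -/

section WeightDistribution

variable {p : ℕ} [Fact p.Prime] {ι V : Type*} [Fintype ι] [AddCommGroup V] [Module (ZMod p) V]
  [Fintype V]

open Classical in
lemma weightCount_range {φ : V →ₗ[ZMod p] (ι → ZMod p)} (hφ : Function.Injective φ) (w : ℕ) :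
    weightCount (LinearMap.range φ) w = (Finset.univ.filter fun a => hammingNorm (φ a) = w).card := by
  rw [weightCount, ← Set.ncard_coe_finset, ← Set.ncard_image_of_injective _ hφ]
  congr 1
  ext c
  simp only [LinearMap.mem_range, Finset.coe_filter, Finset.mem_univ, true_and, Set.mem_image,
    Set.mem_ofPred_eq]
  constructor
  · rintro ⟨⟨a, rfl⟩, h⟩; exact ⟨a, h, rfl⟩
  · rintro ⟨a, h, rfl⟩; exact ⟨⟨a, rfl⟩, h⟩

open Classical in
/-- If the weight is constant on the four classes of a partition of the message space, then the
classes give the weight distribution. -/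
lemma hasWeightDistribution_range {φ : V →ₗ[ZMod p] (ι → ZMod p)} (hφ : Function.Injective φ)
    (cls : V → Fin 4) (wt : Fin 4 → ℝ) (h : ∀ a, (hammingNorm (φ a) : ℝ) = wt (cls a)) :
    HasWeightDistribution (LinearMap.range φ)
      [(wt 0, (Finset.univ.filter fun a => cls a = 0).card),
       (wt 1, (Finset.univ.filter fun a => cls a = 1).card),
       (wt 2, (Finset.univ.filter fun a => cls a = 2).card),
       (wt 3, (Finset.univ.filter fun a => cls a = 3).card)] := by
  intro w
  rw [weightCount_range hφ, Finset.card_eq_sum_card_fiberwise (f := cls) (t := Finset.univ)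
    (by simp)]
  have key (i : Fin 4) : (((Finset.univ.filter fun a => hammingNorm (φ a) = w).filter
      fun a => cls a = i).card : ℝ)
      = if wt i = w then ((Finset.univ.filter fun a => cls a = i).card : ℝ) else 0 := by
    split_ifs with hi
    · rw [Finset.filter_filter]
      congr 2
      ext a
      simp only [Finset.mem_filter, Finset.mem_univ, true_and, and_iff_right_iff_imp]
      intro ha
      have := h a
      rw [ha, hi] at this
      exact_mod_cast this
    · rw [Finset.filter_filter, Nat.cast_eq_zero, Finset.card_eq_zero,
        Finset.filter_eq_empty_iff]
      rintro a - ⟨h1, rfl⟩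
      exact hi (by rw [← h a, h1])
  rw [Nat.cast_sum, Fin.sum_univ_four, key, key, key, key]
  simp only [List.map_cons, List.map_nil, List.sum_cons, List.sum_nil, add_zero]
  ring

lemma isWeightCode_three {φ : V →ₗ[ZMod p] (ι → ZMod p)} (hφ : Function.Injective φ)
    {w₁ w₂ w₃ : ℕ} (hpos : ∀ a, a ≠ 0 → hammingNorm (φ a) = w₁ ∨ hammingNorm (φ a) = w₂ ∨
      hammingNorm (φ a) = w₃) (h₁ : ∃ a ≠ 0, hammingNorm (φ a) = w₁)
    (h₂ : ∃ a ≠ 0, hammingNorm (φ a) = w₂) (h₃ : ∃ a ≠ 0, hammingNorm (φ a) = w₃)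
    (h12 : w₁ ≠ w₂) (h13 : w₁ ≠ w₃) (h23 : w₂ ≠ w₃) :
    IsWeightCode (LinearMap.range φ) 3 := by
  classical
  have hne (w : ℕ) : weightCount (LinearMap.range φ) w ≠ 0 ↔ ∃ a, hammingNorm (φ a) = w := by
    rw [weightCount_range hφ, Finset.card_ne_zero, Finset.filter_nonempty_iff]
    simp
  have hge {w : ℕ} (h : ∃ a ≠ 0, hammingNorm (φ a) = w) :
      1 ≤ w ∧ weightCount (LinearMap.range φ) w ≠ 0 := by
    obtain ⟨a, ha, rfl⟩ := h
    refine ⟨hammingNorm_pos_iff.2 fun h0 => ha (hφ (h0.trans (map_zero φ).symm)), ?_⟩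
    exact (hne _).2 ⟨a, rfl⟩
  rw [IsWeightCode, Set.ncard_eq_three]
  refine ⟨w₁, w₂, w₃, h12, h13, h23, Set.ext fun w => ?_⟩
  simp only [Set.mem_ofPred_eq, Set.mem_insert_iff, Set.mem_singleton_iff]
  constructor
  · rintro ⟨hw, hw'⟩
    obtain ⟨a, rfl⟩ := (hne w).1 hw'
    refine hpos a ?_
    rintro rfl
    simp at hw
  · rintro (rfl | rfl | rfl)
    exacts [hge h₁, hge h₂, hge h₃]

end WeightDistribution

/-! ### Parameters and weight table -/

section PuncturedCode

variable {p : ℕ} [Fact p.Prime] {F : Type*} [Field F] [Fintype F] [Algebra (ZMod p) F]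
  {f g : F → ZMod p} {Hs : F × F → ZMod p} {S : Set (F × F)} {e : ℤ} {E : Finset (F × F)}
  {m k : ℕ}

lemma card_dual_zeros_eq (hk : k ≤ m)
    (h : IsWalshDual (fun v : F × F => f v.1 + g v.2) Hs (pairForm p F) S
      ((e : ℚ) * (p : ℚ) ^ (m + k)))
    (he : e = 1 ∨ e = -1) (hV : Fintype.card (F × F) = p ^ (2 * m))
    (hS : S.ncard = p ^ (2 * (m - k))) :
    open Classical in
    (p : ℝ) * (Finset.univ.filter fun a => a ∈ S ∧ Hs a = 0).card
      = (p : ℝ) ^ (2 * (m - k)) + ((p : ℝ) - 1) * (e * (p : ℝ) ^ (m - k)) := by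
  classical
  have hp : (p : ℚ) ≠ 0 := by exact_mod_cast (Fact.out : p.Prime).ne_zero
  have h1 := h.card_dual_zeros
  have h2 : (Finset.univ.filter fun a => a ∈ S).card = p ^ (2 * (m - k)) := by
    rw [← hS, ← Set.ncard_coe_finset]; simp
  have h3 : ((Fintype.card (F × F) : ℕ) : ℚ) / (e * (p : ℚ) ^ (m + k)) = e * (p : ℚ) ^ (m - k) := by
    rw [hV, show 2 * m = (m + k) + (m - k) by omega, pow_add]
    rcases he with rfl | rfl <;> push_cast <;> field_simp
  rw [h2, h3] at h1
  exact_mod_cast h1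

open Classical in
lemma hammingNorm_codeMap_real (hm : 2 ≤ m)
    (h : IsWalshDual (fun v : F × F => f v.1 + g v.2) Hs (pairForm p F) S
      ((e : ℚ) * (p : ℚ) ^ (m + k)))
    (hV : Fintype.card (F × F) = p ^ (2 * m))
    (hE : IsPuncturing p (definingSet f g) E) {a : F × F} (ha : a ≠ 0) :
    (hammingNorm (codeMap p E a) : ℝ) = if a ∈ S then if Hs a = 0 then (p : ℝ) ^ (2 * m - 2)
      else (p : ℝ) ^ (2 * m - 2) + e * (p : ℝ) ^ (m + k - 1)
      else (p : ℝ) ^ (2 * m - 2) + ((p : ℝ) - 1) * e * (p : ℝ) ^ (m + k - 2) := by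
  have hp : (p : ℝ) ^ 2 ≠ 0 := by
    have := (Fact.out : p.Prime).pos
    positivity
  have h1 := hammingNorm_codeMap_eq h hE ha
  obtain ⟨M, rfl⟩ := Nat.exists_eq_add_of_le' hm
  rw [hV] at h1
  have h2 : (p : ℝ) ^ 2 * hammingNorm (codeMap p E a) = (p : ℝ) ^ (2 * (M + 2)) +
      if a ∈ S then if Hs a = 0 then 0 else (p : ℝ) * (e * (p : ℝ) ^ (M + 2 + k))
        else ((p : ℝ) - 1) * (e * (p : ℝ) ^ (M + 2 + k)) := by
    exact_mod_cast h1
  apply mul_left_cancel₀ hp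
  rw [h2, show 2 * (M + 2) - 2 = 2 * M + 2 by omega, show M + 2 + k - 1 = M + k + 1 by omega,
    show M + 2 + k - 2 = M + k by omega]
  split_ifs <;> ring

lemma card_puncturing_real (hm : 2 ≤ m)
    (h : IsWalshDual (fun v : F × F => f v.1 + g v.2) Hs (pairForm p F) S
      ((e : ℚ) * (p : ℚ) ^ (m + k)))
    (hV : Fintype.card (F × F) = p ^ (2 * m))
    (hE : IsPuncturing p (definingSet f g) E) :
    (E.card : ℝ) = ((p : ℝ) ^ (2 * m - 1) - 1) / ((p : ℝ) - 1) + e * (p : ℝ) ^ (m + k - 1) := by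
  have hp0 : (p : ℝ) ≠ 0 := by exact_mod_cast (Fact.out : p.Prime).ne_zero
  have hp1 : (p : ℝ) - 1 ≠ 0 := by
    have : (1 : ℝ) < p := by exact_mod_cast (Fact.out : p.Prime).one_lt
    linarith
  have h1 := card_puncturing h hE
  obtain ⟨M, rfl⟩ := Nat.exists_eq_add_of_le' hm
  rw [hV] at h1
  have h2 : (p : ℝ) * (((p : ℝ) - 1) * E.card) = (p : ℝ) ^ (2 * (M + 2))
      + ((p : ℝ) - 1) * (e * (p : ℝ) ^ (M + 2 + k)) - p := by
    exact_mod_cast h1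
  rw [show 2 * (M + 2) - 1 = 2 * M + 3 by omega, show M + 2 + k - 1 = M + k + 1 by omega]
  field_simp
  apply mul_left_cancel₀ hp0
  linear_combination h2

/-- The case `γ = 0`, `ε = -1` does not occur. -/
lemma sub_ne_zero_of_neg (hp : p % 4 = 1) (hk : k ≤ m)
    (h : IsWalshDual (fun v : F × F => f v.1 + g v.2) Hs (pairForm p F) S
      ((e : ℚ) * (p : ℚ) ^ (m + k)))
    (he : e = -1) (hV : Fintype.card (F × F) = p ^ (2 * m))
    (hS : S.ncard = p ^ (2 * (m - k))) : m - k ≠ 0 := by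
  classical
  intro h0
  have h1 := card_dual_zeros_eq hk h (Or.inr he) hV hS
  have h5 : 5 ≤ p := by have := (Fact.out : p.Prime).two_le; omega
  have h5' : (5 : ℝ) ≤ p := by exact_mod_cast h5
  rw [h0, he] at h1
  push_cast at h1
  -- With `k = m` and `ε = -1`, `p` times this count would be `1 - (p - 1) < 0`.
  have : (0 : ℝ) ≤ (p : ℝ) * (Finset.univ.filter fun a => a ∈ S ∧ Hs a = 0).card := by positivity
  rw [h1] at this
  norm_num at this
  linarith

/-- Only `ε = -1` could spoil positivity. Then `m - k ≥ 2`, so `p^(m+k-1) < p^(2m-2)`. In the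
excluded case `m - k = 1` these powers agree and the second weight is `0`. -/
lemma hammingNorm_codeMap_pos (hp : p % 4 = 1) (hm : 2 ≤ m) (hk : k ≤ m)
    (h : IsWalshDual (fun v : F × F => f v.1 + g v.2) Hs (pairForm p F) S
      ((e : ℚ) * (p : ℚ) ^ (m + k)))
    (he : e = 1 ∨ e = -1) (hV : Fintype.card (F × F) = p ^ (2 * m))
    (hS : S.ncard = p ^ (2 * (m - k))) (hex : ¬ (m - k = 1 ∧ e = -1))
    (hE : IsPuncturing p (definingSet f g) E) {a : F × F} (ha : a ≠ 0) :
    0 < hammingNorm (codeMap p E a) := by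
  classical
  have h1 := hammingNorm_codeMap_real hm h hV hE ha
  have hp1 : (1 : ℝ) < p := by exact_mod_cast (Fact.out : p.Prime).one_lt
  have hp0 : (0 : ℝ) < p := by linarith
  have hp2 : (0 : ℝ) < (p : ℝ) - 1 := by linarith
  suffices (0 : ℝ) < hammingNorm (codeMap p E a) by exact_mod_cast this
  rw [h1]
  rcases he with rfl | rfl
  · split_ifs <;> push_cast <;> positivity
  · have h2 := sub_ne_zero_of_neg hp hk h rfl hV hS
    have h3 : (p : ℝ) ^ (m + k - 1) < (p : ℝ) ^ (2 * m - 2) :=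
      pow_lt_pow_right₀ hp1 (by omega)
    have h4 : (p : ℝ) ^ (m + k - 1) = (p : ℝ) ^ (m + k - 2) * p := by
      rw [← pow_succ]; congr 1; omega
    have h5 : (0 : ℝ) < (p : ℝ) ^ (m + k - 2) := by positivity
    split_ifs
    · positivity
    · push_cast; linarith
    · push_cast; nlinarith

lemma injective_codeMap_of_pos (hpos : ∀ a : F × F, a ≠ 0 → 0 < hammingNorm (codeMap p E a)) :
    Function.Injective (codeMap p E) := by
  rw [injective_iff_map_eq_zero]
  intro a ha
  by_contra h0
  have := hpos a h0
  rw [ha] at this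
  simp at this

lemma finrank_code (hF : Module.finrank (ZMod p) F = m)
    (hinj : Function.Injective (codeMap p E)) : Module.finrank (ZMod p) (code p E) = 2 * m := by
  rw [code, LinearMap.finrank_range_of_inj hinj, Module.finrank_prod, hF, two_mul]

lemma hasWeightDistribution_code (hm : 2 ≤ m) (hk : k ≤ m)
    (h : IsWalshDual (fun v : F × F => f v.1 + g v.2) Hs (pairForm p F) S
      ((e : ℚ) * (p : ℚ) ^ (m + k)))
    (he : e = 1 ∨ e = -1) (hV : Fintype.card (F × F) = p ^ (2 * m))
    (hS : S.ncard = p ^ (2 * (m - k))) (hinj : Function.Injective (codeMap p E))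
    (hE : IsPuncturing p (definingSet f g) E) :
    HasWeightDistribution (code p E)
      [(0, 1),
       ((p : ℝ) ^ (2 * m - 2),
        ((p : ℝ) ^ (2 * (m - k)) + ((p : ℝ) - 1) * (e * (p : ℝ) ^ (m - k))) / p - 1),
       ((p : ℝ) ^ (2 * m - 2) + e * (p : ℝ) ^ (m + k - 1),
        ((p : ℝ) - 1) * ((p : ℝ) ^ (2 * (m - k)) - e * (p : ℝ) ^ (m - k)) / p),
       ((p : ℝ) ^ (2 * m - 2) + ((p : ℝ) - 1) * e * (p : ℝ) ^ (m + k - 2),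
        (p : ℝ) ^ (2 * m) - (p : ℝ) ^ (2 * (m - k)))] := by
  classical
  have hp0 : (p : ℝ) ≠ 0 := by exact_mod_cast (Fact.out : p.Prime).ne_zero
  have hK := card_dual_zeros_eq hk h he hV hS
  have hSc : (Finset.univ.filter fun a => a ∈ S).card = p ^ (2 * (m - k)) := by
    rw [← hS, ← Set.ncard_coe_finset]; simp
  -- The origin lies in `S` with `Hs 0 = 0`; testing it first removes it from class `1`, whence the
  -- `- 1` in that frequency.
  let cls (a : F × F) : Fin 4 :=
    if a = 0 then 0 else if a ∈ S then if Hs a = 0 then 1 else 2 else 3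
  let wt : Fin 4 → ℝ := ![0, (p : ℝ) ^ (2 * m - 2),
    (p : ℝ) ^ (2 * m - 2) + e * (p : ℝ) ^ (m + k - 1),
    (p : ℝ) ^ (2 * m - 2) + ((p : ℝ) - 1) * e * (p : ℝ) ^ (m + k - 2)]
  have hwt (a : F × F) : (hammingNorm (codeMap p E a) : ℝ) = wt (cls a) := by
    by_cases ha : a = 0
    · simp [ha, cls, wt]
    · rw [hammingNorm_codeMap_real hm h hV hE ha]
      simp only [cls, if_neg ha]
      split_ifs <;> simp [wt]
  have hdist := hasWeightDistribution_range hinj cls wt hwt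
  have c0 : ((Finset.univ.filter fun a => cls a = 0).card : ℝ) = 1 := by
    have : (Finset.univ.filter fun a => cls a = 0) = {0} := by
      ext a
      simp only [cls, Finset.mem_filter, Finset.mem_univ, true_and, Finset.mem_singleton]
      split_ifs <;> simp_all
    rw [this]; simp
  have c1' : (Finset.univ.filter fun a => cls a = 1).card + 1
      = (Finset.univ.filter fun a => a ∈ S ∧ Hs a = 0).card := by
    rw [← Finset.card_erase_add_one (s := Finset.univ.filter fun a => a ∈ S ∧ Hs a = 0) (a := 0)
      (by simp [h.zero_mem, h.dual_zero])]
    congr 2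
    ext a
    simp only [cls, Finset.mem_filter, Finset.mem_univ, true_and, Finset.mem_erase]
    split_ifs <;> simp_all
  have c2' : (Finset.univ.filter fun a => a ∈ S ∧ Hs a = 0).card
      + (Finset.univ.filter fun a => cls a = 2).card = p ^ (2 * (m - k)) := by
    rw [← hSc, ← Finset.card_filter_add_card_filter_not (s := Finset.univ.filter fun a => a ∈ S)
      (fun a => Hs a = 0), Finset.filter_filter, Finset.filter_filter]
    congr 2
    ext a
    have := h.dual_zero
    simp only [cls, Finset.mem_filter, Finset.mem_univ, true_and]
    split_ifs <;> simp_all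
  have c3' : p ^ (2 * (m - k)) + (Finset.univ.filter fun a => cls a = 3).card = p ^ (2 * m) := by
    rw [← hV, ← hSc, ← Finset.card_univ, ← Finset.card_filter_add_card_filter_not
      (s := Finset.univ) (fun a => a ∈ S)]
    congr 2
    ext a
    have := h.zero_mem
    simp only [cls, Finset.mem_filter, Finset.mem_univ, true_and]
    split_ifs <;> simp_all
  have c1 : ((Finset.univ.filter fun a => cls a = 1).card : ℝ)
      = ((p : ℝ) ^ (2 * (m - k)) + ((p : ℝ) - 1) * (e * (p : ℝ) ^ (m - k))) / p - 1 := by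
    rw [← hK, mul_div_cancel_left₀ _ hp0, ← c1']
    push_cast; ring
  have c2 : ((Finset.univ.filter fun a => cls a = 2).card : ℝ)
      = ((p : ℝ) - 1) * ((p : ℝ) ^ (2 * (m - k)) - e * (p : ℝ) ^ (m - k)) / p := by
    rw [eq_div_iff hp0]
    have c2R := congrArg (Nat.cast (R := ℝ)) c2'
    push_cast at c2R
    linear_combination (p : ℝ) * c2R - hK
  have c3 : ((Finset.univ.filter fun a => cls a = 3).card : ℝ)
      = (p : ℝ) ^ (2 * m) - (p : ℝ) ^ (2 * (m - k)) := by
    have c3R := congrArg (Nat.cast (R := ℝ)) c3'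
    push_cast at c3R
    linear_combination c3R
  rw [c0, c1, c2, c3] at hdist
  exact hdist

end PuncturedCode

lemma exists_notMem_support {p : ℕ} (hp : p.Prime) {V : Type*} [Fintype V] {S : Set V} {m k : ℕ}
    (hk : k ≤ m) (hk0 : k ≠ 0) (hV : Fintype.card V = p ^ (2 * m)) (hS : S.ncard = p ^ (2 * (m - k))) :
    ∃ a, a ∉ S := by
  by_contra! h
  rw [Set.eq_univ_of_forall h, Set.ncard_univ, Nat.card_eq_fintype_card, hV] at hS
  have := Nat.pow_right_injective hp.two_le hS
  omega

/-! ### Nonempty weight classes and the Griesmer bound -/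

section WeightClasses

variable {p : ℕ} [Fact p.Prime] {F : Type*} [Field F] [Fintype F] [Algebra (ZMod p) F]
  {f g : F → ZMod p} {Hs : F × F → ZMod p} {S : Set (F × F)} {e : ℤ} {E : Finset (F × F)}
  {m k : ℕ}

/-- If `Hs` vanished on `S`, the count would give `(p-1) p^G (p^G - ε) = 0` with `G = m - k > 0`. -/
lemma exists_dual_ne_zero (hk : k ≤ m)
    (h : IsWalshDual (fun v : F × F => f v.1 + g v.2) Hs (pairForm p F) S
      ((e : ℚ) * (p : ℚ) ^ (m + k)))
    (he : e = 1 ∨ e = -1) (hV : Fintype.card (F × F) = p ^ (2 * m))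
    (hS : S.ncard = p ^ (2 * (m - k))) (hG : m - k ≠ 0) : ∃ a ∈ S, Hs a ≠ 0 := by
  classical
  by_contra! h0
  have hK := card_dual_zeros_eq hk h he hV hS
  have h1 : (Finset.univ.filter fun a => a ∈ S ∧ Hs a = 0).card = p ^ (2 * (m - k)) := by
    rw [← hS, ← Set.ncard_coe_finset]
    congr 1
    ext a
    simpa using h0 a
  rw [h1] at hK
  push_cast at hK
  have hp1 : (1 : ℝ) < p := by exact_mod_cast (Fact.out : p.Prime).one_lt
  have h2 : (1 : ℝ) < (p : ℝ) ^ (m - k) := one_lt_pow₀ hp1 hG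
  rw [two_mul, pow_add] at hK
  have h3 : ((p : ℝ) - 1) * (p : ℝ) ^ (m - k) * ((p : ℝ) ^ (m - k) - e) = 0 := by
    linear_combination hK
  have h4 : (e : ℝ) ≤ 1 := by rcases he with rfl | rfl <;> norm_num
  have : 0 < ((p : ℝ) - 1) * (p : ℝ) ^ (m - k) * ((p : ℝ) ^ (m - k) - e) :=
    mul_pos (mul_pos (by linarith) (by linarith)) (by linarith)
  linarith

/-- If the origin were the only zero, then `p = p^(2G) + (p-1) ε p^G` with `G = m - k`. For `G > 0`
this holds only when `G = 1` and `ε = -1`. -/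
lemma exists_dual_eq_zero (hk : k ≤ m)
    (h : IsWalshDual (fun v : F × F => f v.1 + g v.2) Hs (pairForm p F) S
      ((e : ℚ) * (p : ℚ) ^ (m + k)))
    (he : e = 1 ∨ e = -1) (hV : Fintype.card (F × F) = p ^ (2 * m))
    (hS : S.ncard = p ^ (2 * (m - k))) (hG : m - k ≠ 0) (hex : ¬ (m - k = 1 ∧ e = -1)) :
    ∃ a ∈ S, Hs a = 0 ∧ a ≠ 0 := by
  classical
  by_contra! h0
  have hK := card_dual_zeros_eq hk h he hV hS
  have h1 : (Finset.univ.filter fun a => a ∈ S ∧ Hs a = 0) = {0} := by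
    ext a
    simp only [Finset.mem_filter, Finset.mem_univ, true_and, Finset.mem_singleton]
    refine ⟨fun ha => h0 a ha.1 ha.2, ?_⟩
    rintro rfl
    exact ⟨h.zero_mem, h.dual_zero⟩
  rw [h1, Finset.card_singleton, Nat.cast_one, mul_one, two_mul, pow_add] at hK
  have hp1 : (1 : ℝ) < p := by exact_mod_cast (Fact.out : p.Prime).one_lt
  have h2 : (p : ℝ) ≤ (p : ℝ) ^ (m - k) := le_self_pow₀ hp1.le hG
  rcases he with rfl | rfl
  · push_cast at hK
    nlinarith [mul_pos (show (0 : ℝ) < p - 1 by linarith) (show (0 : ℝ) < p ^ (m - k) by linarith)]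
  · push_cast at hK
    have h3 : (p : ℝ) ^ 2 ≤ (p : ℝ) ^ (m - k) := pow_le_pow_right₀ hp1.le (by omega)
    nlinarith [mul_nonneg (show (0 : ℝ) ≤ p ^ (m - k) by linarith)
      (show (0 : ℝ) ≤ p ^ (m - k) - p by linarith)]

lemma isWeightCode_code (hm : 2 ≤ m) (hk : k ≤ m)
    (h : IsWalshDual (fun v : F × F => f v.1 + g v.2) Hs (pairForm p F) S
      ((e : ℚ) * (p : ℚ) ^ (m + k)))
    (he : e = 1 ∨ e = -1) (hV : Fintype.card (F × F) = p ^ (2 * m))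
    (hS : S.ncard = p ^ (2 * (m - k))) (hinj : Function.Injective (codeMap p E))
    (hE : IsPuncturing p (definingSet f g) E) (hk0 : k ≠ 0) (hG : m - k ≠ 0)
    (hex : ¬ (m - k = 1 ∧ e = -1)) : IsWeightCode (code p E) 3 := by
  classical
  obtain ⟨a₁, ha₁, hd₁, h0₁⟩ := exists_dual_eq_zero hk h he hV hS hG hex
  obtain ⟨a₂, ha₂, hd₂⟩ := exists_dual_ne_zero hk h he hV hS hG
  obtain ⟨a₃, ha₃⟩ := exists_notMem_support (Fact.out : p.Prime) hk hk0 hV hS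
  have h0₂ : a₂ ≠ 0 := by rintro rfl; exact hd₂ h.dual_zero
  have h0₃ : a₃ ≠ 0 := by rintro rfl; exact ha₃ h.zero_mem
  have hw {a : F × F} (ha : a ≠ 0) := hammingNorm_codeMap_real hm h hV hE ha
  have hw₁ := hw h0₁
  have hw₂ := hw h0₂
  have hw₃ := hw h0₃
  rw [if_pos ha₁, if_pos hd₁] at hw₁
  rw [if_pos ha₂, if_neg hd₂] at hw₂
  rw [if_neg ha₃] at hw₃
  have hp1 : (1 : ℝ) < p := by exact_mod_cast (Fact.out : p.Prime).one_lt
  have hpj : (0 : ℝ) < (p : ℝ) ^ (m + k - 2) := by positivity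
  have hj : (p : ℝ) ^ (m + k - 1) = (p : ℝ) ^ (m + k - 2) * p := by
    rw [← pow_succ]; congr 1; omega
  have he0 : (e : ℝ) ≠ 0 := by rcases he with rfl | rfl <;> norm_num
  rw [hj] at hw₂
  refine isWeightCode_three hinj ?_ ⟨a₁, h0₁, rfl⟩ ⟨a₂, h0₂, rfl⟩ ⟨a₃, h0₃, rfl⟩ ?_ ?_ ?_
  · intro a ha
    have hwa := hw ha
    split_ifs at hwa
    · left; rw [← hw₁] at hwa; exact_mod_cast hwa
    · right; left; rw [hj, ← hw₂] at hwa; exact_mod_cast hwa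
    · right; right; rw [← hw₃] at hwa; exact_mod_cast hwa
  · intro heq
    have heq' := congrArg (Nat.cast (R := ℝ)) heq
    rw [hw₁, hw₂] at heq'
    have : (e : ℝ) * ((p : ℝ) ^ (m + k - 2) * p) ≠ 0 :=
      mul_ne_zero he0 (mul_ne_zero hpj.ne' (by linarith))
    exact this (by linarith)
  · intro heq
    have heq' := congrArg (Nat.cast (R := ℝ)) heq
    rw [hw₁, hw₃] at heq'
    have : ((p : ℝ) - 1) * e * (p : ℝ) ^ (m + k - 2) ≠ 0 :=
      mul_ne_zero (mul_ne_zero (by linarith) he0) hpj.ne'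
    exact this (by linarith)
  · intro heq
    have heq' := congrArg (Nat.cast (R := ℝ)) heq
    rw [hw₂, hw₃] at heq'
    have : (e : ℝ) * (p : ℝ) ^ (m + k - 2) ≠ 0 := mul_ne_zero he0 hpj.ne'
    exact this (by linear_combination heq')

/-- These are the parameters `[p² + 1, 4, p(p-1)]` of an ovoid code, and `p(p-1) + (p-1) + 1 + 1 =
p² + 1`. -/
lemma meetsGriesmer_code (hp : p % 4 = 1) (hF : Module.finrank (ZMod p) F = 2)
    (h : IsWalshDual (fun v : F × F => f v.1 + g v.2) Hs (pairForm p F) S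
      (((-1 : ℤ) : ℚ) * (p : ℚ) ^ (2 + 0)))
    (hV : Fintype.card (F × F) = p ^ (2 * 2))
    (hS : S.ncard = p ^ (2 * (2 - 0)))
    (hE : IsPuncturing p (definingSet f g) E) : MeetsGriesmer (code p E) := by
  classical
  have hpp : p.Prime := Fact.out
  have hp1 : (1 : ℝ) < p := by exact_mod_cast hpp.one_lt
  have hpos := fun a (ha : a ≠ 0) => hammingNorm_codeMap_pos hp le_rfl (Nat.zero_le 2) h
    (Or.inr rfl) hV hS (by simp) hE ha
  have hinj := injective_codeMap_of_pos hpos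
  have hn := card_puncturing_real le_rfl h hV hE
  have hw (a : F × F) (ha : a ≠ 0) := hammingNorm_codeMap_real le_rfl h hV hE ha
  obtain ⟨b, hb, hdb⟩ := exists_dual_ne_zero (Nat.zero_le 2) h (Or.inr rfl) hV hS (by simp)
  have hb0 : b ≠ 0 := by rintro rfl; exact hdb h.dual_zero
  obtain ⟨q, rfl⟩ : ∃ q, p = q + 1 := ⟨p - 1, by have := hpp.pos; omega⟩
  have hq0 : 0 < q := by have := hpp.two_le; omega
  have hqR : (0 : ℝ) < q := by exact_mod_cast hq0
  have hqQ : (0 : ℚ) < q := by exact_mod_cast hq0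
  have hwb : hammingNorm (codeMap (q + 1) E b) = (q + 1) * q := by
    have := hw b hb0
    rw [if_pos hb, if_neg hdb] at this
    have h2 : (hammingNorm (codeMap (q + 1) E b) : ℝ) = ((q + 1) * q : ℕ) := by
      rw [this]; push_cast; norm_num; ring
    exact_mod_cast h2
  -- All three formulas, `p²`, `p² - p` and `p² - (p-1)`, satisfy the bound, so it is not needed
  -- that `S` is everything.
  have hge (a : F × F) (ha : a ≠ 0) : (q + 1) * q ≤ hammingNorm (codeMap (q + 1) E a) := by
    have h2 : (((q + 1) * q : ℕ) : ℝ) ≤ hammingNorm (codeMap (q + 1) E a) := by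
      rw [hw a ha]
      push_cast
      norm_num
      split_ifs <;> nlinarith
    exact_mod_cast h2
  refine ⟨(q + 1) * q, le_antisymm ?_ ?_, ?_⟩
  · rw [← hwb]
    refine iInf₂_le (codeMap (q + 1) E b) ⟨⟨b, rfl⟩, fun h0 => hb0 (hinj ?_)⟩
    rw [h0, map_zero]
  · refine le_iInf₂ ?_
    rintro _ ⟨⟨a, rfl⟩, ha⟩
    exact_mod_cast hge a (by rintro rfl; exact ha (map_zero _))
  · have hcard : E.card = (q + 1) ^ 2 + 1 := by
      have h2 : (E.card : ℝ) = (((q + 1) ^ 2 + 1 : ℕ) : ℝ) := by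
        rw [hn]
        push_cast
        norm_num
        field_simp
        ring
      exact_mod_cast h2
    have c0 : ⌈(((q + 1) * q : ℕ) : ℚ) / ((q + 1 : ℕ) : ℚ) ^ 0⌉₊ = (q + 1) * q := by
      rw [pow_zero, div_one, Nat.ceil_natCast]
    have c1 : ⌈(((q + 1) * q : ℕ) : ℚ) / ((q + 1 : ℕ) : ℚ) ^ 1⌉₊ = q := by
      have : (((q + 1) * q : ℕ) : ℚ) / ((q + 1 : ℕ) : ℚ) ^ 1 = (q : ℕ) := by
        push_cast; field_simp
      rw [this, Nat.ceil_natCast]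
    have c2 : ⌈(((q + 1) * q : ℕ) : ℚ) / ((q + 1 : ℕ) : ℚ) ^ 2⌉₊ = 1 := by
      rw [Nat.ceil_eq_iff one_ne_zero]
      push_cast
      constructor
      · positivity
      · rw [div_le_one (by positivity)]; nlinarith
    have c3 : ⌈(((q + 1) * q : ℕ) : ℚ) / ((q + 1 : ℕ) : ℚ) ^ 3⌉₊ = 1 := by
      rw [Nat.ceil_eq_iff one_ne_zero]
      push_cast
      constructor
      · positivity
      · rw [div_le_one (by positivity)]; nlinarith [pow_pos hqQ 3, pow_pos hqQ 2]
    rw [Fintype.card_coe, hcard, finrank_code hF hinj, show 2 * 2 = 3 + 1 by rfl,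
      Finset.sum_range_succ, Finset.sum_range_succ, Finset.sum_range_succ, Finset.sum_range_one,
      c0, c1, c2, c3]
    ring

end WeightClasses

lemma sqrt_zpow_two_mul (p : ℕ) (j : ℤ) : √(p : ℝ) ^ (2 * j) = (p : ℝ) ^ j := by
  rw [zpow_mul, zpow_ofNat, Real.sq_sqrt (Nat.cast_nonneg p)]

end PlateauedCode

end

/-! ### The theorem in terms of `τ` and `γ` -/

theorem mainTheorem5 (p : ℕ) [Fact p.Prime] (hp : p % 4 = 1)
    {F : Type*} [Field F] [Fintype F] [Algebra (ZMod p) F]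
    (m : ℕ) (hm : 2 ≤ m) (hF : Module.finrank (ZMod p) F = m)
    (f g : F → ZMod p) (s t : ℕ)
    (hf : PlateauedCode.IsWRP f s) (hg : PlateauedCode.IsWRP g t)
    (hlf : PlateauedCode.IsIndex f s ((p - 1) / 2))
    (hlg : PlateauedCode.IsIndex g t ((p - 1) / 2))
    (hst : Even (s + t))
    (ε : ℝ)
    (hε : ε = (PlateauedCode.walshSign f s : ℝ) * (PlateauedCode.walshSign g t : ℝ))
    (τ γ : ℤ) (hτ : τ = 2 * m + s + t) (hγ : γ = 2 * m - s - t) :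
    (∃ E : Finset (F × F),
      PlateauedCode.IsPuncturing p (PlateauedCode.definingSet f g) E) ∧
    ∀ E : Finset (F × F), PlateauedCode.IsPuncturing p (PlateauedCode.definingSet f g) E →
      PlateauedCode.IsProjective (PlateauedCode.code p E) ∧
      (E.card : ℝ) = ((p : ℝ) ^ (2 * m - 1) - 1) / ((p : ℝ) - 1) + ε * √(p : ℝ) ^ (τ - 2) ∧
      (¬ (γ = 2 ∧ ε = -1) →
        Module.finrank (ZMod p) (PlateauedCode.code p E) = 2 * m ∧
        PlateauedCode.HasWeightDistribution (PlateauedCode.code p E)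
          [(0, 1),
           ((p : ℝ) ^ (2 * m - 2),
            (p : ℝ) ^ (γ - 1) + ((p : ℝ) - 1) * ε * √(p : ℝ) ^ (γ - 2) - 1),
           ((p : ℝ) ^ (2 * m - 2) + ε * √(p : ℝ) ^ (τ - 2),
            ((p : ℝ) - 1) * ((p : ℝ) ^ (γ - 1) - ε * √(p : ℝ) ^ (γ - 2))),
           ((p : ℝ) ^ (2 * m - 2) + ((p : ℝ) - 1) * ε * √(p : ℝ) ^ (τ - 4),
            (p : ℝ) ^ (2 * m) - (p : ℝ) ^ γ)] ∧
        (0 < s + t → s + t < 2 * m →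
          PlateauedCode.IsWeightCode (PlateauedCode.code p E) 3)) ∧
      (τ = 4 → ε = -1 → PlateauedCode.MeetsGriesmer (PlateauedCode.code p E)) := by
  obtain ⟨k, hk⟩ := hst
  have hpp : p.Prime := Fact.out
  have hp0 : (p : ℝ) ≠ 0 := by exact_mod_cast hpp.ne_zero
  obtain ⟨hkm, hS⟩ := PlateauedCode.card_walshSupport_prod hF hf.weaklyRegular.1
    hg.weaklyRegular.1 hk
  have h := PlateauedCode.isWalshDual hp hF hf hg hlf hlg hk
  have h0 : (0 : F × F) ∉ PlateauedCode.definingSet f g := fun h => h.1 rfl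
  have hV : Fintype.card (F × F) = p ^ (2 * m) := by
    rw [Fintype.card_prod, PlateauedCode.card_eq_pow hF, ← pow_add, two_mul]
  obtain ⟨e, hes⟩ : ∃ e : ℤ,
    e = PlateauedCode.walshSign f s * PlateauedCode.walshSign g t := ⟨_, rfl⟩
  have he : e = 1 ∨ e = -1 := by
    rw [hes, PlateauedCode.walshSign, PlateauedCode.walshSign]
    split_ifs <;> simp
  have hεe : ε = e := by rw [hε, hes]; push_cast; ring
  rw [← hes] at h
  have hτ' : τ = 2 * ((m + k : ℕ) : ℤ) := by push_cast; omega
  have hγ' : γ = 2 * ((m - k : ℕ) : ℤ) := by push_cast [hkm]; omega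
  have hexc : ¬ (γ = 2 ∧ ε = -1) → ¬ (m - k = 1 ∧ e = -1) := by
    rintro hne ⟨h1, h2⟩
    refine hne ⟨by rw [hγ', h1]; rfl, by rw [hεe, h2]; norm_num⟩
  have pτ2 : √(p : ℝ) ^ (τ - 2) = (p : ℝ) ^ (m + k - 1) := by
    rw [hτ', show 2 * ((m + k : ℕ) : ℤ) - 2 = 2 * ((m + k - 1 : ℕ) : ℤ) by omega,
      PlateauedCode.sqrt_zpow_two_mul, zpow_natCast]
  have pτ4 : √(p : ℝ) ^ (τ - 4) = (p : ℝ) ^ (m + k - 2) := by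
    rw [hτ', show 2 * ((m + k : ℕ) : ℤ) - 4 = 2 * ((m + k - 2 : ℕ) : ℤ) by omega,
      PlateauedCode.sqrt_zpow_two_mul, zpow_natCast]
  have pγ : (p : ℝ) ^ γ = (p : ℝ) ^ (2 * (m - k)) := by
    rw [hγ', ← zpow_natCast]; push_cast; rfl
  have pγ1 : (p : ℝ) ^ (γ - 1) = (p : ℝ) ^ (2 * (m - k)) / p := by
    rw [zpow_sub_one₀ hp0, pγ, div_eq_mul_inv]
  -- `γ` may be `0`, so the exponent can be negative and a division by `p` is kept.
  have pγ2 : √(p : ℝ) ^ (γ - 2) = (p : ℝ) ^ (m - k) / p := by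
    rw [hγ', show 2 * ((m - k : ℕ) : ℤ) - 2 = 2 * (((m - k : ℕ) : ℤ) - 1) by ring,
      PlateauedCode.sqrt_zpow_two_mul, zpow_sub_one₀ hp0, zpow_natCast, div_eq_mul_inv]
  refine ⟨PlateauedCode.exists_isPuncturing h0
    (PlateauedCode.definingSet_smul hp hf hg hlf hlg), fun E hE =>
    ⟨PlateauedCode.isProjective_code h0 hE, ?_, fun hne => ?_, fun hτ4 hε1 => ?_⟩⟩
  · rw [pτ2, hεe]
    exact PlateauedCode.card_puncturing_real hm h hV hE
  · have hinj := PlateauedCode.injective_codeMap_of_pos fun a ha =>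
      PlateauedCode.hammingNorm_codeMap_pos hp hm hkm h he hV hS (hexc hne) hE ha
    refine ⟨PlateauedCode.finrank_code hF hinj, ?_, fun h1 h2 =>
      PlateauedCode.isWeightCode_code hm hkm h he hV hS hinj hE (by omega) (by omega) (hexc hne)⟩
    have := PlateauedCode.hasWeightDistribution_code hm hkm h he hV hS hinj hE
    rw [pτ2, pτ4, pγ, pγ1, pγ2, hεe]
    have q1 : (p : ℝ) ^ (2 * (m - k)) / p + ((p : ℝ) - 1) * e * ((p : ℝ) ^ (m - k) / p) - 1
        = ((p : ℝ) ^ (2 * (m - k)) + ((p : ℝ) - 1) * (e * (p : ℝ) ^ (m - k))) / p - 1 := by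
      ring
    have q2 : ((p : ℝ) - 1) * ((p : ℝ) ^ (2 * (m - k)) / p - e * ((p : ℝ) ^ (m - k) / p))
        = ((p : ℝ) - 1) * ((p : ℝ) ^ (2 * (m - k)) - e * (p : ℝ) ^ (m - k)) / p := by
      ring
    rw [q1, q2]
    exact this
  · have hk0 : k = 0 := by omega
    have hm2 : m = 2 := by omega
    have he1 : e = -1 := by
      rw [hεe] at hε1
      exact_mod_cast hε1
    subst hk0 hm2 he1
    exact PlateauedCode.meetsGriesmer_code hp hF h hV hS hE
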